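/- A \emph{quantum query algorithm} for an oracle $O$ (a unitary on $n+a$ qubits) has a finite memory of qubits, started in the all-zero state, that consists of a control qubit, an $(n+a)$-qubit oracle register, an output qubit and some number of work qubits. It performs a fixed finite sequence of steps, each of which is either a unitary on the memory that does not depend on $O$, or one \emph{query}, i.e. one application of the controlled oracle $|0\rangle\langle 0|\otimes I+|1\rangle\langle 1|\otimes O$ or of its inverse to the control qubit and the oracle register. At the end the output qubit is measured in the standard basis. There is an absolute constant $C>0$ such that for all integers $n,a\ge 0$ and all real $\tau\in(0,1)$, $\varepsilon\in(0,\tau)$ and $\delta\in(0,1)$ there is a quantum query algorithm (depending only on $n,a,\tau,\varepsilon,\delta$) which makes at most $$\frac{C}{\varepsilon\tau}\,\log\frac{1}{\delta\tau}$$ queries and decides the promise version of the HighAmp problem with error at most $\delta$. That is, for every oracle $O$ on $n+a$ qubits, written as $$O\,|0^{n+a}\rangle=\sum_{x\in\{0,1\}^n}\alpha_x\,|x\rangle|\psi_x\rangle$$ with complex $\alpha_x$ and unit vectors $|\psi_x\rangle$ on $a$ qubits: \begin{enumerate} \item if $|\alpha_x|\ge\tau$ for some $x$, then the output qubit is observed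 as $1$ with probability at least $1-\delta$; \item if $|\alpha_x|<\tau-\varepsilon$ for all $x$, then the output qubit is observed as $0$ with probability at least $1-\delta$. \end{enumerate} -/

import Mathlib

/-! ## Quantum query algorithms with access to a state-generating oracle -/

/-- The standard basis states of a register of `k` qubits. -/
abbrev Bits (k : ℕ) : Type := Fin k → Bool

/-- The all-zero basis state `0^k`. -/
def zeroBits (k : ℕ) : Bits k := fun _ => false

/-- Basis states of the `(n + a)`-qubit register on which the oracle acts: `n` qubits that hold the
outcome `x`, and `a` further qubits. -/
abbrev OracleBits (n a : ℕ) : Type := Bits n × Bits a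

/-- An oracle: a unitary operator on `n + a` qubits. -/
abbrev Oracle (n a : ℕ) : Type := Matrix.unitaryGroup (OracleBits n a) ℂ

/-- `Generates O α ψ` says that `O |0^(n+a)⟩ = ∑ x, α x • |x⟩|ψ x⟩` with all `|ψ x⟩` normalized. -/
def Generates {n a : ℕ} (O : Oracle n a) (α : Bits n → ℂ)
    (ψ : Bits n → EuclideanSpace ℂ (Bits a)) : Prop :=
  (∀ x, ‖ψ x‖ = 1) ∧
    (O : Matrix (OracleBits n a) (OracleBits n a) ℂ).mulVec
      (Pi.single (zeroBits n, zeroBits a) 1) = fun p => α p.1 * ψ p.1 p.2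

/-- Basis states of the whole memory of an algorithm: one control qubit, the `(n + a)`-qubit
register on which the oracle is applied, one output qubit, and `w` work qubits. -/
abbrev Memory (n a w : ℕ) : Type := Bool × OracleBits n a × Bool × Bits w

/-- The operator that applies `M` to the second register if the control qubit is `1`, and nothing if
the control qubit is `0`:  `|0⟩⟨0| ⊗ I ⊗ I + |1⟩⟨1| ⊗ M ⊗ I`. -/
noncomputable def controlledOp {n a w : ℕ} (M : Matrix (OracleBits n a) (OracleBits n a) ℂ) :
    Matrix (Memory n a w) (Memory n a w) ℂ :=
  Matrix.of fun s t =>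
    if s.1 = t.1 ∧ s.2.2 = t.2.2 then
      (if s.1 = true then M s.2.1 t.2.1
        else (1 : Matrix (OracleBits n a) (OracleBits n a) ℂ) s.2.1 t.2.1)
    else 0

/-- One step of a quantum query algorithm: a unitary on the whole memory that is independent of the
oracle, or a call to the controlled oracle, or a call to its inverse. -/
inductive QStep (n a w : ℕ) : Type
  | gate (U : Matrix.unitaryGroup (Memory n a w) ℂ) : QStep n a w
  | query : QStep n a w
  | queryInv : QStep n a w

/-- The operator performed by a step when the oracle is `O`. -/
noncomputable def QStep.op {n a w : ℕ} (O : Oracle n a) :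
    QStep n a w → Matrix (Memory n a w) (Memory n a w) ℂ
  | .gate U => (U : Matrix (Memory n a w) (Memory n a w) ℂ)
  | .query => controlledOp (O : Matrix (OracleBits n a) (OracleBits n a) ℂ)
  | .queryInv => controlledOp ((O : Matrix (OracleBits n a) (OracleBits n a) ℂ).conjTranspose)

/-- The number of oracle calls in a step. -/
def QStep.cost {n a w : ℕ} : QStep n a w → ℕ
  | .gate _ => 0
  | .query => 1
  | .queryInv => 1

/-- A quantum query algorithm for oracles on `n + a` qubits: a number of work qubits and a finite
sequence of steps (the head of the list is performed first). -/
structure QueryAlgorithm (n a : ℕ) where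
  workQubits : ℕ
  steps : List (QStep n a workQubits)

namespace QueryAlgorithm

variable {n a : ℕ}

/-- The number of calls to the (controlled) oracle or to its inverse. -/
def queries (A : QueryAlgorithm n a) : ℕ := (A.steps.map QStep.cost).sum

/-- The initial state, in which all qubits are `|0⟩`. -/
noncomputable def startState (w : ℕ) : Memory n a w → ℂ :=
  Pi.single (false, (zeroBits n, zeroBits a), false, zeroBits w) 1

/-- The state of the memory after all steps have been performed. -/
noncomputable def finalState (A : QueryAlgorithm n a) (O : Oracle n a) :
    Memory n a A.workQubits → ℂ :=
  A.steps.foldl (fun v s => (s.op O).mulVec v) (startState A.workQubits)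

/-- The probability that the output qubit is observed as `b` when the final state is measured in the
standard basis. -/
noncomputable def outputProb (A : QueryAlgorithm n a) (O : Oracle n a) (b : Bool) : ℝ :=
  ∑ s : Memory n a A.workQubits, if s.2.2.1 = b then ‖A.finalState O s‖ ^ 2 else 0

/-- The algorithm solves the promise version of HighAmp with threshold `τ` and additive accuracy `ε`
with error at most `δ`: for every oracle `O`, with `O |0^(n+a)⟩ = ∑ x, α x • |x⟩|ψ x⟩`, the output is
`1` with probability at least `1 - δ` if `|α x| ≥ τ` for some `x`, and it is `0` with probability at
least `1 - δ` if `|α x| < τ - ε` for all `x`. -/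
def SolvesHighAmp (A : QueryAlgorithm n a) (τ ε δ : ℝ) : Prop :=
  ∀ (O : Oracle n a) (α : Bits n → ℂ) (ψ : Bits n → EuclideanSpace ℂ (Bits a)),
    Generates O α ψ →
      ((∃ x, τ ≤ ‖α x‖) → 1 - δ ≤ A.outputProb O true) ∧
      ((∀ x, ‖α x‖ < τ - ε) → 1 - δ ≤ A.outputProb O false)

end QueryAlgorithm

open scoped InnerProductSpace

/-! Let `φ` be the state generated by the oracle and `Y x = ‖α x‖ ^ 2` the probability of the label
`x`. The proof builds an oracle-dependent operator, costing four queries, that multiplies a clock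
state `e` by `1` or by `-1` according to the case of the promise, provided that it is run next to a
suitable auxiliary vector `v`, the catalyst: `e + v` goes to `e + v`, or nearly to `-e + v`.

The catalyst is never prepared. Since `v` is returned after each use, `K` copies of the operator,
one for each of `K` orthogonal clock states, can share it. On the sum of the clock states, of norm
`√K`, its absence at the start costs at most `2 * ‖v‖` (`exists_impl_product`). So `K` of order `‖v‖
^ 2` gives a constant error, and interference with a reference state turns the sign into an output
(`exists_impl_sign`).

The operator is a walk on a line of sites. At a site with label `x` it stays in the plane spanned by
the part of `φ` with label `x` and the remaining part, of squared norms `Y x` and `1 - Y x`. Three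
reflections act in turn: one in the entry vector, which couples the clock to site `0` for all labels
at once; one about `φ`, with a sign alternating along the sites; and one that links neighbouring
sites with amplitude ratio `c = t / √(1 - t²)`, where `t = τ - ε / 2`. A common fixed vector is
geometric along the line with ratio `-c² (1 - Y) / Y`, which decays exactly when `Y > t²`. A vector
negated by the last two reflections has ratio `-(Y / (1 - Y)) / c²`, which decays exactly when `Y <
t²`. The first gives the catalyst for the sign `1`, the second for the sign `-1`
(`walkStep_invariant`, `walkStep_negate`).

Both catalysts have squared norm at most `4 / (ε τ)`. In the small case the contribution of each
label is proportional to `Y x`, and these sum to `1`; this is why the number of labels does not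
matter (`exists_catalyst`). A majority vote over `O(log (1 / δ))` runs reduces the error to `δ`. -/

/-! ### Unitary matrices and linear isometries -/

/-- The linear isometry of Euclidean space given by a unitary matrix. -/
noncomputable def unitaryIso {I : Type*} [Fintype I] [DecidableEq I] (U : Matrix.unitaryGroup I ℂ) :
    EuclideanSpace ℂ I ≃ₗᵢ[ℂ] EuclideanSpace ℂ I :=
  Unitary.linearIsometryEquiv ⟨Matrix.toEuclideanCLM (n := I) (𝕜 := ℂ) U, Unitary.map_mem _ U.2⟩

theorem ofLp_unitaryIso {I : Type*} [Fintype I] [DecidableEq I] (U : Matrix.unitaryGroup I ℂ)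
    (v : EuclideanSpace ℂ I) :
    (unitaryIso U v).ofLp = (U : Matrix I I ℂ).mulVec v.ofLp := rfl

theorem unitaryIso_symm {I : Type*} [Fintype I] [DecidableEq I] (U : Matrix.unitaryGroup I ℂ) :
    (unitaryIso U).symm = unitaryIso U⁻¹ := by
  ext1 v
  rw [LinearIsometryEquiv.symm_apply_eq]
  refine WithLp.ofLp_injective 2 ?_
  rw [ofLp_unitaryIso, ofLp_unitaryIso, Matrix.mulVec_mulVec, ← Submonoid.coe_mul,
    mul_inv_cancel, Submonoid.coe_one, Matrix.one_mulVec]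

theorem unitaryIso_surjective {I : Type*} [Fintype I] [DecidableEq I] :
    Function.Surjective (unitaryIso : Matrix.unitaryGroup I ℂ → _) := by
  intro g
  obtain ⟨⟨u, hu⟩, rfl⟩ :=
    (Unitary.linearIsometryEquiv (𝕜 := ℂ) (H := EuclideanSpace ℂ I)).surjective g
  obtain ⟨M, rfl⟩ : ∃ M, Matrix.toEuclideanCLM (n := I) (𝕜 := ℂ) M = u :=
    (Matrix.toEuclideanCLM (n := I) (𝕜 := ℂ)).surjective u
  have hM : M ∈ Matrix.unitaryGroup I ℂ := by
    rw [Matrix.mem_unitaryGroup_iff]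
    have h : Matrix.toEuclideanCLM (n := I) (𝕜 := ℂ) (M * star M) =
        Matrix.toEuclideanCLM (n := I) (𝕜 := ℂ) 1 := by
      rw [map_mul, map_star, map_one]
      exact (Unitary.mem_iff.mp hu).2
    exact (Matrix.toEuclideanCLM (n := I) (𝕜 := ℂ)).injective h
  exact ⟨⟨M, hM⟩, rfl⟩

/-- An isometry defined on a finite-dimensional space, seen through an embedding into a larger space,
extends to the larger space. -/
theorem exists_isometry_extension {F E : Type*} [NormedAddCommGroup F] [InnerProductSpace ℂ F]
    [NormedAddCommGroup E] [InnerProductSpace ℂ E] [FiniteDimensional ℂ E]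
    (J J' : F →ₗᵢ[ℂ] E) : ∃ g : E ≃ₗᵢ[ℂ] E, ∀ v, g (J v) = J' v := by
  let L : LinearMap.range J.toLinearMap →ₗᵢ[ℂ] E :=
    J'.comp J.equivRange.symm.toLinearIsometry
  refine ⟨L.extend.toLinearIsometryEquiv rfl, fun v => ?_⟩
  have h : L.extend (J.equivRange v : E) = L (J.equivRange v) := L.extend_apply _
  have h2 : L (J.equivRange v) = J' v := by
    change J' (J.equivRange.symm (J.equivRange v)) = J' v
    rw [LinearIsometryEquiv.symm_apply_apply]
  rw [h2] at h
  exact h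

/-- Supplies oracle-independent gates from a prescription on finitely many orthonormal states. Each
family is the image of the standard basis under an isometric embedding, and one embedding extends to
the other. -/
theorem exists_isometry_of_orthonormal {ι E : Type*} [Fintype ι] [NormedAddCommGroup E]
    [InnerProductSpace ℂ E] [FiniteDimensional ℂ E] {v w : ι → E} (hv : Orthonormal ℂ v)
    (hw : Orthonormal ℂ w) : ∃ g : E ≃ₗᵢ[ℂ] E, ∀ i, g (v i) = w i := by
  classical
  have key : ∀ {u : ι → E}, Orthonormal ℂ u →
      ∃ J : EuclideanSpace ℂ ι →ₗᵢ[ℂ] E, ∀ i, J (EuclideanSpace.single i 1) = u i := by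
    intro u hu
    let b := EuclideanSpace.basisFun ι ℂ
    have hb : Orthonormal ℂ ((b.toBasis.constr ℂ u : EuclideanSpace ℂ ι →ₗ[ℂ] E) ∘ b.toBasis) := by
      convert hu using 1
      ext i
      simp
    refine ⟨(b.toBasis.constr ℂ u).isometryOfOrthonormal (v := b.toBasis)
      (by rw [b.coe_toBasis]; exact b.orthonormal) hb, fun i => ?_⟩
    have : EuclideanSpace.single i (1 : ℂ) = b.toBasis i := by simp [b]
    rw [this, LinearMap.coe_isometryOfOrthonormal, Module.Basis.constr_basis]
  obtain ⟨J, hJ⟩ := key hv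
  obtain ⟨J', hJ'⟩ := key hw
  obtain ⟨g, hg⟩ := exists_isometry_extension J J'
  exact ⟨g, fun i => by rw [← hJ, hg, hJ']⟩

/-! ### Operators that can be implemented with a given number of queries -/

/-- Basis states of a control qubit, an oracle register and a work register with basis `W`. -/
abbrev Reg (n a : ℕ) (W : Type) : Type := Bool × OracleBits n a × W

/-- The states of `Reg n a W`. -/
abbrev RegSpace (n a : ℕ) (W : Type) [Fintype W] : Type := EuclideanSpace ℂ (Reg n a W)

/-- The controlled application of a matrix to the oracle register. -/
def ctrlMatrix {n a : ℕ} (W : Type) [DecidableEq W]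
    (M : Matrix (OracleBits n a) (OracleBits n a) ℂ) : Matrix (Reg n a W) (Reg n a W) ℂ :=
  Matrix.of fun s t =>
    if s.1 = t.1 ∧ s.2.2 = t.2.2 then
      (if s.1 = true then M s.2.1 t.2.1
        else (1 : Matrix (OracleBits n a) (OracleBits n a) ℂ) s.2.1 t.2.1)
    else 0

section
variable {n a : ℕ} {W : Type} [Fintype W] [DecidableEq W]
set_option linter.unusedSectionVars false

theorem ctrlMatrix_mulVec_true (M : Matrix (OracleBits n a) (OracleBits n a) ℂ)
    (v : Reg n a W → ℂ) (p : OracleBits n a) (w : W) :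
    (ctrlMatrix W M).mulVec v (true, p, w) = M.mulVec (fun q => v (true, q, w)) p := by
  simp only [ctrlMatrix, Matrix.mulVec, dotProduct, Matrix.of_apply]
  rw [Fintype.sum_prod_type, Fintype.sum_bool]
  simp only [Fintype.sum_prod_type (α₁ := OracleBits n a)]
  simp [ite_mul]

theorem ctrlMatrix_mulVec_false (M : Matrix (OracleBits n a) (OracleBits n a) ℂ)
    (v : Reg n a W → ℂ) (p : OracleBits n a) (w : W) :
    (ctrlMatrix W M).mulVec v (false, p, w) = v (false, p, w) := by
  simp only [ctrlMatrix, Matrix.mulVec, dotProduct, Matrix.of_apply]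
  rw [Fintype.sum_prod_type, Fintype.sum_bool]
  simp only [Fintype.sum_prod_type (α₁ := OracleBits n a)]
  simp [ite_mul, Matrix.one_apply]

theorem ctrlMatrix_mul (M N : Matrix (OracleBits n a) (OracleBits n a) ℂ) :
    ctrlMatrix W (M * N) = ctrlMatrix W M * ctrlMatrix W N := by
  refine Matrix.mulVec_injective (funext fun v => funext fun s => ?_)
  obtain ⟨c, p, w⟩ := s
  rw [← Matrix.mulVec_mulVec]
  cases c
  · simp [ctrlMatrix_mulVec_false]
  · simp [ctrlMatrix_mulVec_true]

theorem ctrlMatrix_one : ctrlMatrix W (1 : Matrix (OracleBits n a) (OracleBits n a) ℂ) = 1 := by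
  refine Matrix.mulVec_injective (funext fun v => funext fun s => ?_)
  obtain ⟨c, p, w⟩ := s
  cases c
  · simp [ctrlMatrix_mulVec_false]
  · simp [ctrlMatrix_mulVec_true]

theorem ctrlMatrix_conjTranspose (M : Matrix (OracleBits n a) (OracleBits n a) ℂ) :
    (ctrlMatrix W M).conjTranspose = ctrlMatrix W M.conjTranspose := by
  ext ⟨c, p, w⟩ ⟨c', p', w'⟩
  simp only [ctrlMatrix, Matrix.conjTranspose_apply, Matrix.of_apply, Matrix.one_apply]
  by_cases h : c = c' ∧ w = w'
  · obtain ⟨rfl, rfl⟩ := h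
    cases c <;> simp [eq_comm]
  · rw [if_neg h, if_neg (by rintro ⟨h1, h2⟩; exact h ⟨h1.symm, h2.symm⟩)]
    simp

/-- The controlled oracle as a unitary matrix. -/
def ctrlUnitary (W : Type) [Fintype W] [DecidableEq W] (O : Oracle n a) :
    Matrix.unitaryGroup (Reg n a W) ℂ :=
  ⟨ctrlMatrix W (O : Matrix (OracleBits n a) (OracleBits n a) ℂ), by
    rw [Matrix.mem_unitaryGroup_iff, Matrix.star_eq_conjTranspose, ctrlMatrix_conjTranspose,
      ← ctrlMatrix_mul, ← Matrix.star_eq_conjTranspose, Matrix.mem_unitaryGroup_iff.mp O.2,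
      ctrlMatrix_one]⟩

/-- The controlled oracle as an isometry. -/
noncomputable def ctrlIso (W : Type) [Fintype W] [DecidableEq W] (O : Oracle n a) :
    RegSpace n a W ≃ₗᵢ[ℂ] RegSpace n a W :=
  unitaryIso (ctrlUnitary W O)

theorem ctrlIso_symm (O : Oracle n a) : (ctrlIso W O).symm = ctrlIso W O⁻¹ := by
  unfold ctrlIso
  rw [unitaryIso_symm]
  congr 1
  refine Subtype.ext ?_
  change star (ctrlMatrix W _) = ctrlMatrix W (star _)
  rw [Matrix.star_eq_conjTranspose, ctrlMatrix_conjTranspose, Matrix.star_eq_conjTranspose]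

theorem ctrlIso_true (O : Oracle n a) (v : RegSpace n a W) (p : OracleBits n a) (w : W) :
    ctrlIso W O v (true, p, w) =
      (O : Matrix (OracleBits n a) (OracleBits n a) ℂ).mulVec (fun q => v (true, q, w)) p :=
  ctrlMatrix_mulVec_true _ _ _ _

theorem ctrlIso_false (O : Oracle n a) (v : RegSpace n a W) (p : OracleBits n a) (w : W) :
    ctrlIso W O v (false, p, w) = v (false, p, w) :=
  ctrlMatrix_mulVec_false _ _ _ _

/-- `Impl W k T`: the oracle-dependent operator `T` is a product of fixed isometries and of `k` calls
to the controlled oracle or its inverse. -/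
inductive Impl (W : Type) [Fintype W] [DecidableEq W] :
    ℕ → (Oracle n a → RegSpace n a W ≃ₗᵢ[ℂ] RegSpace n a W) → Prop
  | gate (g : RegSpace n a W ≃ₗᵢ[ℂ] RegSpace n a W) : Impl W 0 fun _ => g
  | query : Impl W 1 fun O => ctrlIso W O
  | queryInv : Impl W 1 fun O => (ctrlIso W O).symm
  | comp {k l : ℕ} {S T : Oracle n a → RegSpace n a W ≃ₗᵢ[ℂ] RegSpace n a W} :
      Impl W k S → Impl W l T → Impl W (k + l) fun O => (S O).trans (T O)

/-- An implementable operator on `Bool × Bits w` is performed by a list of steps. -/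
theorem Impl.exists_steps {w k : ℕ}
    {T : Oracle n a → RegSpace n a (Bool × Bits w) ≃ₗᵢ[ℂ] RegSpace n a (Bool × Bits w)}
    (h : Impl (Bool × Bits w) k T) :
    ∃ l : List (QStep n a w), (l.map QStep.cost).sum = k ∧
      ∀ (O : Oracle n a) (v : RegSpace n a (Bool × Bits w)),
        l.foldl (fun v s => (s.op O).mulVec v) v.ofLp = (T O v).ofLp := by
  induction h with
  | gate g =>
    obtain ⟨U, rfl⟩ := unitaryIso_surjective g
    exact ⟨[.gate U], rfl, fun O v => rfl⟩
  | query => exact ⟨[.query], rfl, fun O v => rfl⟩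
  | queryInv =>
    refine ⟨[.queryInv], rfl, fun O v => ?_⟩
    simp only [ctrlIso_symm]
    rfl
  | comp _ _ ih₁ ih₂ =>
    obtain ⟨l₁, c₁, h₁⟩ := ih₁
    obtain ⟨l₂, c₂, h₂⟩ := ih₂
    exact ⟨l₁ ++ l₂, by simp [c₁, c₂], fun O v => by
      rw [List.foldl_append, h₁, h₂]; rfl⟩

/-- Extension by zero along an embedding of work registers. -/
noncomputable def extendWork {W W' : Type} [Fintype W] [Fintype W'] (n a : ℕ) (f : W ↪ W') :
    RegSpace n a W →ₗᵢ[ℂ] RegSpace n a W' where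
  toFun v := WithLp.toLp 2 fun s => Function.extend f (fun w => v (s.1, s.2.1, w)) 0 s.2.2
  map_add' u v := by
    ext ⟨c, p, w⟩
    by_cases h : ∃ x, f x = w
    · obtain ⟨x, rfl⟩ := h
      simp [f.injective.extend_apply]
    · simp [Function.extend_apply' _ _ _ h]
  map_smul' r v := by
    ext ⟨c, p, w⟩
    by_cases h : ∃ x, f x = w
    · obtain ⟨x, rfl⟩ := h
      simp [f.injective.extend_apply]
    · simp [Function.extend_apply' _ _ _ h]
  norm_map' v := by
    rw [EuclideanSpace.norm_eq, EuclideanSpace.norm_eq]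
    congr 1
    symm
    refine Fintype.sum_of_injective (fun s : Reg n a W => (s.1, s.2.1, f s.2.2)) ?_ _ _ ?_ ?_
    · rintro ⟨c, p, w⟩ ⟨c', p', w'⟩ h
      simpa using h
    · rintro ⟨c, p, w⟩ h
      have : ¬ ∃ x, f x = w := fun ⟨x, hx⟩ => h ⟨(c, p, x), by simp [hx]⟩
      simp [Function.extend_apply' _ _ _ this]
    · rintro ⟨c, p, w⟩
      simp [f.injective.extend_apply]

theorem extendWork_apply {W W' : Type} [Fintype W] [Fintype W'] (f : W ↪ W')
    (v : RegSpace n a W) (c : Bool) (p : OracleBits n a) (w : W) :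
    extendWork n a f v (c, p, f w) = v (c, p, w) :=
  f.injective.extend_apply (fun w => v (c, p, w)) 0 w

theorem extendWork_apply' {W W' : Type} [Fintype W] [Fintype W'] (f : W ↪ W')
    (v : RegSpace n a W) (c : Bool) (p : OracleBits n a) (w : W') (h : ¬ ∃ x, f x = w) :
    extendWork n a f v (c, p, w) = 0 :=
  Function.extend_apply' (fun w => v (c, p, w)) (0 : W' → ℂ) w h

theorem extendWork_single {W W' : Type} [Fintype W] [Fintype W'] [DecidableEq W] [DecidableEq W']
    (f : W ↪ W') (c : Bool) (p : OracleBits n a) (w : W) (r : ℂ) :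
    extendWork n a f (EuclideanSpace.single (c, p, w) r) =
      EuclideanSpace.single (c, p, f w) r := by
  ext ⟨c', p', w'⟩
  by_cases h : ∃ x, f x = w'
  · obtain ⟨x, rfl⟩ := h
    rw [extendWork_apply]
    simp [PiLp.single_apply]
  · rw [extendWork_apply' _ _ _ _ _ h, PiLp.single_apply, if_neg]
    simp only [Prod.mk.injEq, not_and]
    rintro _ _ rfl
    exact h ⟨w, rfl⟩

/-- The query does not touch the work register, so it acts on each value of that register separately
and keeps zero slices zero. -/
theorem ctrlIso_extendWork {W' : Type} [Fintype W'] [DecidableEq W'] (f : W ↪ W') (O : Oracle n a)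
    (v : RegSpace n a W) :
    ctrlIso W' O (extendWork n a f v) = extendWork n a f (ctrlIso W O v) := by
  ext ⟨c, p, w⟩
  by_cases h : ∃ x, f x = w
  · obtain ⟨x, rfl⟩ := h
    rw [extendWork_apply]
    cases c
    · rw [ctrlIso_false, ctrlIso_false, extendWork_apply]
    · simp only [ctrlIso_true, extendWork_apply]
  · rw [extendWork_apply' _ _ _ _ _ h]
    cases c
    · rw [ctrlIso_false, extendWork_apply' _ _ _ _ _ h]
    · simp only [ctrlIso_true, extendWork_apply' _ _ _ _ _ h]
      exact congrFun (Matrix.mulVec_zero _) p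

theorem Impl.extendWork {W' : Type} [Fintype W'] [DecidableEq W'] (f : W ↪ W') {k : ℕ}
    {T : Oracle n a → RegSpace n a W ≃ₗᵢ[ℂ] RegSpace n a W} (h : Impl W k T) :
    ∃ T' : Oracle n a → RegSpace n a W' ≃ₗᵢ[ℂ] RegSpace n a W', Impl W' k T' ∧
      ∀ O v, T' O (_root_.extendWork n a f v) = _root_.extendWork n a f (T O v) := by
  induction h with
  | gate g =>
    obtain ⟨g', hg'⟩ := exists_isometry_extension (_root_.extendWork n a f)
      ((_root_.extendWork n a f).comp g.toLinearIsometry)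
    exact ⟨_, .gate g', fun _ v => hg' v⟩
  | query => exact ⟨_, .query, fun O v => ctrlIso_extendWork f O v⟩
  | queryInv =>
    exact ⟨_, .queryInv, fun O v => by
      simp only [ctrlIso_symm, ctrlIso_extendWork]⟩
  | comp _ _ ih₁ ih₂ =>
    obtain ⟨S, hS, h₁⟩ := ih₁
    obtain ⟨T, hT, h₂⟩ := ih₂
    exact ⟨_, hS.comp hT, fun O v => by
      simp only [LinearIsometryEquiv.trans_apply, h₁, h₂]⟩

/-- The product of a state with a state of an additional work register. -/
def tensorWork {W Y : Type} [Fintype W] [Fintype Y] (v : RegSpace n a W) (η : Y → ℂ) :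
    RegSpace n a (W × Y) :=
  WithLp.toLp 2 fun s => v (s.1, s.2.1, s.2.2.1) * η s.2.2.2

/-- Apply `g` to the slice at each `y`. The squared norm is the sum over the slices, so this is
again an isometry. -/
theorem exists_gate_tensorWork (Y : Type) [Fintype Y]
    (g : RegSpace n a W ≃ₗᵢ[ℂ] RegSpace n a W) :
    ∃ g' : RegSpace n a (W × Y) ≃ₗᵢ[ℂ] RegSpace n a (W × Y),
      ∀ v (η : Y → ℂ), g' (tensorWork v η) = tensorWork (g v) η := by
  let slice : RegSpace n a (W × Y) → Y → RegSpace n a W := fun v y =>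
    WithLp.toLp 2 fun s => v (s.1, s.2.1, s.2.2, y)
  have norm_slice : ∀ v, ‖v‖ ^ 2 = ∑ y, ‖slice v y‖ ^ 2 := by
    intro v
    simp only [EuclideanSpace.norm_sq_eq, slice]
    rw [Finset.sum_comm]
    simp only [Fintype.sum_prod_type]
  let L : RegSpace n a (W × Y) →ₗᵢ[ℂ] RegSpace n a (W × Y) :=
    { toFun := fun v => WithLp.toLp 2 fun s => g (slice v s.2.2.2) (s.1, s.2.1, s.2.2.1)
      map_add' := fun u v => by
        ext s
        have : slice (u + v) s.2.2.2 = slice u s.2.2.2 + slice v s.2.2.2 := by ext; simp [slice]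
        simp [this]
      map_smul' := fun r v => by
        ext s
        have : slice (r • v) s.2.2.2 = r • slice v s.2.2.2 := by ext; simp [slice]
        simp [this]
      norm_map' := fun v => by
        refine (sq_eq_sq₀ (norm_nonneg _) (norm_nonneg _)).mp ?_
        rw [norm_slice v, norm_slice]
        refine Finset.sum_congr rfl fun y _ => ?_
        rw [← g.norm_map (slice v y)]
        rfl }
  refine ⟨L.toLinearIsometryEquiv rfl, fun v η => ?_⟩
  ext s
  have : slice (tensorWork v η) s.2.2.2 = η s.2.2.2 • v := by
    ext; simp [slice, tensorWork, mul_comm]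
  change g (slice (tensorWork v η) s.2.2.2) (s.1, s.2.1, s.2.2.1) = _
  rw [this]
  simp [tensorWork, mul_comm]

theorem ctrlIso_tensorWork {Y : Type} [Fintype Y] [DecidableEq Y] (O : Oracle n a)
    (v : RegSpace n a W) (η : Y → ℂ) :
    ctrlIso (W × Y) O (tensorWork v η) = tensorWork (ctrlIso W O v) η := by
  ext ⟨c, p, w, y⟩
  cases c
  · rw [ctrlIso_false]
    simp [tensorWork, ctrlIso_false]
  · rw [ctrlIso_true]
    simp [tensorWork, ctrlIso_true, Matrix.mulVec, dotProduct, Finset.sum_mul, mul_assoc]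

theorem Impl.tensorWork (Y : Type) [Fintype Y] [DecidableEq Y] {k : ℕ}
    {T : Oracle n a → RegSpace n a W ≃ₗᵢ[ℂ] RegSpace n a W} (h : Impl W k T) :
    ∃ T' : Oracle n a → RegSpace n a (W × Y) ≃ₗᵢ[ℂ] RegSpace n a (W × Y), Impl (W × Y) k T' ∧
      ∀ O v (η : Y → ℂ), T' O (_root_.tensorWork v η) = _root_.tensorWork (T O v) η := by
  induction h with
  | gate g =>
    obtain ⟨g', hg'⟩ := exists_gate_tensorWork Y g
    exact ⟨_, .gate g', fun _ v => hg' v⟩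
  | query => exact ⟨_, .query, fun O v η => ctrlIso_tensorWork O v η⟩
  | queryInv =>
    exact ⟨_, .queryInv, fun O v η => by
      simp only [ctrlIso_symm, ctrlIso_tensorWork]⟩
  | comp _ _ ih₁ ih₂ =>
    obtain ⟨S, hS, h₁⟩ := ih₁
    obtain ⟨T, hT, h₂⟩ := ih₂
    exact ⟨_, hS.comp hT, fun O v η => by
      simp only [LinearIsometryEquiv.trans_apply, h₁, h₂]⟩

end

/-! ### From implementable operators to query algorithms, and repetition -/

section
set_option synthInstance.maxSize 1000
variable {n a : ℕ}

/-- The isometry that permutes the standard basis. -/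
noncomputable def permIso {I : Type*} [Fintype I] (e : I ≃ I) :
    EuclideanSpace ℂ I ≃ₗᵢ[ℂ] EuclideanSpace ℂ I :=
  LinearIsometryEquiv.piLpCongrLeft 2 ℂ ℂ e

theorem permIso_apply {I : Type*} [Fintype I] (e : I ≃ I) (v : EuclideanSpace ℂ I) (i : I) :
    permIso e v i = v (e.symm i) := rfl

theorem permIso_single {I : Type*} [Fintype I] [DecidableEq I] (e : I ≃ I) (i : I) (r : ℂ) :
    permIso e (EuclideanSpace.single i r) = EuclideanSpace.single (e i) r :=
  LinearIsometryEquiv.piLpCongrLeft_single e i r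

/-- An implementable operator, a start state and a classical function of the final basis state give
a query algorithm that outputs the value of this function. -/
theorem Impl.exists_queryAlgorithm {W : Type} [Fintype W] [DecidableEq W] {k : ℕ}
    {T : Oracle n a → RegSpace n a W ≃ₗᵢ[ℂ] RegSpace n a W} (h : Impl W k T) (i₀ : Reg n a W)
    (out : Reg n a W → Bool) :
    ∃ A : QueryAlgorithm n a, A.queries = k ∧ ∀ O b, A.outputProb O b =
      ∑ i, if out i = b then ‖T O (EuclideanSpace.single i₀ 1) i‖ ^ 2 else 0 := by
  classical
  -- One-hot encoding of the work basis in qubits; `f` also sets the output qubit to `0`.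
  let enc : W → Bits (Fintype.card W) := fun w i => decide (i = Fintype.equivFin W w)
  have henc : Function.Injective enc := by
    intro w w' hw
    have := congrFun hw (Fintype.equivFin W w)
    simpa [enc] using this
  let f : W ↪ Bool × Bits (Fintype.card W) := ⟨fun w => (false, enc w), fun w w' hw => by
    simp only [Prod.mk.injEq, true_and] at hw
    exact henc hw⟩
  obtain ⟨T', hT', hTe⟩ := h.extendWork f
  let val : Bool → OracleBits n a → Bits (Fintype.card W) → Bool := fun c p b =>
    decide (∃ w, enc w = b ∧ out (c, p, w) = true)
  have hval : ∀ c p w, val c p (enc w) = out (c, p, w) := by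
    intro c p w
    simp only [val]
    rw [Bool.eq_iff_iff, decide_eq_true_iff]
    exact ⟨fun ⟨w', hw, ho⟩ => henc hw ▸ ho, fun ho => ⟨w, rfl, ho⟩⟩
  -- The classical function is computed reversibly, by adding its value to the output qubit modulo
  -- `2`.
  have hinv : Function.Involutive fun s : Memory n a (Fintype.card W) =>
      ((s.1, s.2.1, xor s.2.2.1 (val s.1 s.2.1 s.2.2.2), s.2.2.2) : Memory n a _) := by
    rintro ⟨c, p, o, b⟩
    simp
  let σ : Memory n a (Fintype.card W) ≃ Memory n a (Fintype.card W) := hinv.toPerm _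
  have hσ : ∀ s, σ (σ s) = s := hinv
  let start : Memory n a (Fintype.card W) :=
    (false, (zeroBits n, zeroBits a), false, zeroBits _)
  obtain ⟨l, hl, hrun⟩ := ((Impl.gate (permIso (Equiv.swap start
    (i₀.1, i₀.2.1, f i₀.2.2)))).comp (hT'.comp (Impl.gate (permIso σ)))).exists_steps
  refine ⟨⟨_, l⟩, by simpa [QueryAlgorithm.queries] using hl, fun O b => ?_⟩
  have hfin : QueryAlgorithm.finalState ⟨_, l⟩ O = fun s : Memory n a (Fintype.card W) =>
      _root_.extendWork n a f (T O (EuclideanSpace.single i₀ 1)) (σ s) := by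
    have h1 := hrun O (EuclideanSpace.single start 1)
    have h2 : (EuclideanSpace.single start (1 : ℂ)).ofLp =
      QueryAlgorithm.startState (Fintype.card W) := by
      ext s
      simp [start, QueryAlgorithm.startState, Pi.single_apply]
    rw [h2] at h1
    unfold QueryAlgorithm.finalState
    rw [h1]
    ext s
    simp only [LinearIsometryEquiv.trans_apply]
    rw [permIso_apply, permIso_single, Equiv.swap_apply_left]
    have h3 : EuclideanSpace.single (i₀.1, i₀.2.1, f i₀.2.2) (1 : ℂ) =
        _root_.extendWork n a f (EuclideanSpace.single i₀ 1) := by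
      obtain ⟨c, p, w⟩ := i₀
      rw [extendWork_single]
    rw [h3, hTe]
    rfl
  unfold QueryAlgorithm.outputProb
  rw [hfin]
  symm
  refine Fintype.sum_of_injective
    (fun i : Reg n a W => σ (i.1, i.2.1, f i.2.2)) ?_ _ _ ?_ ?_
  · rintro ⟨c, p, w⟩ ⟨c', p', w'⟩ hi
    have := σ.injective hi
    simpa using this
  · intro s hs
    have hz : ¬ ∃ x, f x = (σ s).2.2 := by
      rintro ⟨x, hx⟩
      refine hs ⟨((σ s).1, (σ s).2.1, x), ?_⟩
      change σ (_, _, f x) = s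
      rw [hx]
      exact hσ s
    have := extendWork_apply' f (T O (EuclideanSpace.single i₀ 1)) (σ s).1
      (σ s).2.1 (σ s).2.2 hz
    change (if _ then ‖_root_.extendWork n a f _ (σ s)‖ ^ 2 else 0) = (0 : ℝ)
    rw [show σ s = ((σ s).1, (σ s).2.1, (σ s).2.2) from rfl,
      this]
    simp
  · rintro ⟨c, p, w⟩
    have h1 : (σ (c, p, f w)).2.2.1 = out (c, p, w) := by
      change xor false (val c p (enc w)) = _
      rw [hval, Bool.false_xor]
    have h2 : σ (σ (c, p, f w)) = (c, p, f w) := hσ _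
    simp only [h1, h2, extendWork_apply]

/-- Two implementable operators can be performed one after the other on independent registers. -/
theorem Impl.exists_product {W V : Type} [Fintype W] [DecidableEq W] [Fintype V] [DecidableEq V]
    {k l : ℕ} {T : Oracle n a → RegSpace n a W ≃ₗᵢ[ℂ] RegSpace n a W}
    {S : Oracle n a → RegSpace n a V ≃ₗᵢ[ℂ] RegSpace n a V} (hT : Impl W k T) (hS : Impl V l S)
    (i₀ : Reg n a W) (j₀ : Reg n a V) :
    ∃ R : Oracle n a → RegSpace n a (W × Reg n a V) ≃ₗᵢ[ℂ] RegSpace n a (W × Reg n a V),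
      Impl (W × Reg n a V) (k + l) R ∧
      ∀ O c p w c' p' v,
        R O (EuclideanSpace.single (i₀.1, i₀.2.1, i₀.2.2, j₀) 1) (c', p', w, c, p, v) =
          T O (EuclideanSpace.single i₀ 1) (c, p, w) *
          S O (EuclideanSpace.single j₀ 1) (c', p', v) := by
  obtain ⟨T', hT', hTt⟩ := hT.tensorWork (Reg n a V)
  obtain ⟨S', hS', hSt⟩ := hS.tensorWork (W × Bool × OracleBits n a)
  let f : V × (W × Bool × OracleBits n a) ↪ W × Reg n a V :=
    ⟨fun x => (x.2.1, x.2.2.1, x.2.2.2, x.1), by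
      rintro ⟨v, w, c, p⟩ ⟨v', w', c', p'⟩ h
      simp only [Prod.mk.injEq] at h ⊢
      tauto⟩
  obtain ⟨S'', hS'', hSe⟩ := hS'.extendWork f
  -- Between the two runs, the control qubit and oracle register of the first are exchanged with
  -- those parked in the work register for the second.
  have hinv : Function.Involutive fun s : Reg n a (W × Reg n a V) =>
      ((s.2.2.2.1, s.2.2.2.2.1, s.2.2.1, s.1, s.2.1, s.2.2.2.2.2) : Reg n a (W × Reg n a V)) :=
    fun s => rfl
  refine ⟨_, hT'.comp (by simpa using (Impl.gate (permIso (hinv.toPerm _))).comp hS''), ?_⟩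
  intro O c p w c' p' v
  simp only [LinearIsometryEquiv.trans_apply]
  have h1 : EuclideanSpace.single ((i₀.1, i₀.2.1, i₀.2.2, j₀) : Reg n a (W × Reg n a V)) (1 : ℂ) =
      _root_.tensorWork (EuclideanSpace.single i₀ 1) (Pi.single j₀ 1) := by
    ext ⟨c, p, w, j⟩
    obtain ⟨c₀, p₀, w₀⟩ := i₀
    simp only [_root_.tensorWork, PiLp.single_apply, Pi.single_apply, Prod.mk.injEq]
    split_ifs <;> simp_all
  rw [h1, hTt]
  have h2 : permIso (hinv.toPerm _) (_root_.tensorWork (T O (EuclideanSpace.single i₀ 1))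
      (Pi.single j₀ 1)) = _root_.extendWork n a f (_root_.tensorWork (EuclideanSpace.single j₀ 1)
        fun y => T O (EuclideanSpace.single i₀ 1) (y.2.1, y.2.2, y.1)) := by
    ext ⟨c', p', w, c, p, v⟩
    rw [permIso_apply]
    have := extendWork_apply f (_root_.tensorWork (EuclideanSpace.single j₀ 1)
        fun y => T O (EuclideanSpace.single i₀ 1) (y.2.1, y.2.2, y.1)) c' p' (v, w, c, p)
    refine Eq.trans ?_ this.symm
    change T O (EuclideanSpace.single i₀ 1) (c, p, w) * (Pi.single j₀ 1 : Reg n a V → ℂ) (c', p', v) =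
      (EuclideanSpace.single j₀ 1 : RegSpace n a V) (c', p', v) *
        T O (EuclideanSpace.single i₀ 1) (c, p, w)
    rw [mul_comm]
    simp [Pi.single_apply]
  rw [h2, hSe, hSt]
  have := extendWork_apply f (_root_.tensorWork (S O (EuclideanSpace.single j₀ 1))
        fun y => T O (EuclideanSpace.single i₀ 1) (y.2.1, y.2.2, y.1)) c' p' (v, w, c, p)
  refine this.trans ?_
  exact mul_comm _ _

/-- Independent repetition: the generating function of the number of runs that end in a flagged
basis state is a power of that of a single run. -/
theorem Impl.exists_repetition {W : Type} [Fintype W] [DecidableEq W] {k : ℕ}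
    {T : Oracle n a → RegSpace n a W ≃ₗᵢ[ℂ] RegSpace n a W} (hT : Impl W k T) (i₀ : Reg n a W)
    (flag : Reg n a W → ℕ) (m : ℕ) :
    ∃ (V : Type) (_ : Fintype V) (_ : DecidableEq V)
      (S : Oracle n a → RegSpace n a V ≃ₗᵢ[ℂ] RegSpace n a V) (j₀ : Reg n a V)
      (count : Reg n a V → ℕ), Impl V (m * k) S ∧
      ∀ O (θ : ℝ), ∑ j, ‖S O (EuclideanSpace.single j₀ 1) j‖ ^ 2 * θ ^ count j =
        (∑ i, ‖T O (EuclideanSpace.single i₀ 1) i‖ ^ 2 * θ ^ flag i) ^ m := by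
  induction m with
  | zero =>
    refine ⟨Unit, inferInstance, inferInstance, _, (false, (zeroBits n, zeroBits a), ()),
      fun _ => 0, by simpa using Impl.gate (LinearIsometryEquiv.refl ℂ _), fun O θ => ?_⟩
    simp only [pow_zero, mul_one, LinearIsometryEquiv.coe_refl, id]
    rw [← EuclideanSpace.norm_sq_eq]
    simp
  | succ m ih =>
    obtain ⟨V, _, _, S, j₀, count, hS, hc⟩ := ih
    obtain ⟨R, hR, hprod⟩ := hT.exists_product hS i₀ j₀
    refine ⟨_, inferInstance, inferInstance, R, (i₀.1, i₀.2.1, i₀.2.2, j₀),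
      fun s => flag (s.2.2.2.1, s.2.2.2.2.1, s.2.2.1) + count (s.1, s.2.1, s.2.2.2.2.2),
      by rw [add_mul, one_mul, add_comm]; exact hR, fun O θ => ?_⟩
    rw [pow_succ', ← hc, Finset.sum_mul_sum, ← Fintype.sum_prod_type']
    let e : Reg n a W × Reg n a V ≃ Reg n a (W × Reg n a V) :=
      { toFun := fun x => (x.2.1, x.2.2.1, x.1.2.2, x.1.1, x.1.2.1, x.2.2.2)
        invFun := fun s => ((s.2.2.2.1, s.2.2.2.2.1, s.2.2.1), (s.1, s.2.1, s.2.2.2.2.2))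
        left_inv := fun _ => rfl
        right_inv := fun _ => rfl }
    symm
    refine Fintype.sum_equiv e _ _ ?_
    rintro ⟨⟨c, p, w⟩, c', p', v⟩
    simp only [e, Equiv.coe_fn_mk]
    rw [hprod, norm_mul, pow_add]
    ring

end

/-! ### Catalytic evaluation of a sign -/

theorem orthonormal_sum_diff {E : Type*} [NormedAddCommGroup E] [InnerProductSpace ℂ E] {r u : E}
    (hr : ‖r‖ = 1) (hu : ‖u‖ = 1) (hru : ⟪r, u⟫_ℂ = 0) :
    Orthonormal ℂ fun b : Bool =>
      ((Real.sqrt 2)⁻¹ : ℂ) • (r + (if b then (1 : ℂ) else -1) • u) := by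
  have hur : ⟪u, r⟫_ℂ = 0 := inner_eq_zero_symm.mp hru
  have h2 : ((Real.sqrt 2 : ℝ) : ℂ) * (Real.sqrt 2 : ℝ) = 2 := by
    rw [← Complex.ofReal_mul, Real.mul_self_sqrt (by norm_num)]
    norm_num
  have h0 : ((Real.sqrt 2 : ℝ) : ℂ) ≠ 0 := by
    intro h
    rw [h] at h2
    norm_num at h2
  rw [orthonormal_iff_ite]
  intro b b'
  simp only [inner_smul_left, inner_smul_right, inner_add_left, inner_add_right, hru, hur,
    inner_self_eq_norm_sq_to_K, hr, hu]
  cases b <;> cases b' <;> simp <;> field_simp <;> linear_combination -h2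

section
variable {n a : ℕ} {W : Type} [Fintype W] [DecidableEq W]

/-- If each `T t` maps `e t + v` to a vector close to `σ • e t + v` and fixes all other `e t'`, then
the product of all `T t` maps `∑ t, e t` to a vector close to `σ • ∑ t, e t`. -/
theorem exists_impl_product {K q : ℕ}
    {T : Fin K → Oracle n a → RegSpace n a W ≃ₗᵢ[ℂ] RegSpace n a W} (hT : ∀ t, Impl W q (T t))
    (e : Fin K → RegSpace n a W) (hfix : ∀ O t t', t' ≠ t → T t O (e t') = e t')
    (r : RegSpace n a W) (hr : ∀ O t, T t O r = r) :
    ∃ Φ : Oracle n a → RegSpace n a W ≃ₗᵢ[ℂ] RegSpace n a W, Impl W (K * q) Φ ∧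
      ∀ O, Φ O r = r ∧ ∀ (v : RegSpace n a W) (σ : ℂ) (η : ℝ),
        (∀ t, ‖T t O (e t + v) - (σ • e t + v)‖ ≤ η) →
          ‖Φ O (∑ t, e t) - σ • ∑ t, e t‖ ≤ 2 * ‖v‖ + K * η := by
  -- With the catalyst `v` present, the first `i` factors put `σ` on the first `i` vectors, and
  -- isometry makes the errors only add up.
  have key : ∀ i ≤ K, ∃ Φ : Oracle n a → RegSpace n a W ≃ₗᵢ[ℂ] RegSpace n a W, Impl W (i * q) Φ ∧
      ∀ O, Φ O r = r ∧ ∀ (v : RegSpace n a W) (σ : ℂ) (η : ℝ),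
        (∀ t, ‖T t O (e t + v) - (σ • e t + v)‖ ≤ η) →
          ‖Φ O (∑ t, e t + v) - (∑ t : Fin K, (if (t : ℕ) < i then σ else 1) • e t + v)‖
            ≤ i * η := by
    intro i
    induction i with
    | zero =>
      intro _
      refine ⟨_, by simpa using Impl.gate (LinearIsometryEquiv.refl ℂ _), fun O => ⟨rfl, ?_⟩⟩
      intro v σ η _
      simp
    | succ i ih =>
      intro hi
      obtain ⟨Φ, hΦ, h⟩ := ih (by omega)
      let t₀ : Fin K := ⟨i, hi⟩
      refine ⟨_, by rw [add_mul, one_mul]; exact hΦ.comp (hT t₀), fun O => ⟨?_, ?_⟩⟩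
      · simp only [LinearIsometryEquiv.trans_apply, (h O).1, hr]
      intro v σ η hv
      have h1 := (h O).2 v σ η hv
      rw [← (T t₀ O).norm_map, map_sub] at h1
      have h2 := norm_add_le_of_le h1 (hv t₀)
      refine le_trans (le_of_eq ?_) (h2.trans (le_of_eq (by push_cast; ring)))
      simp only [LinearIsometryEquiv.trans_apply]
      congr 1
      have h3 : ∀ c : Fin K → ℂ, ∑ t, c t • e t =
          c t₀ • e t₀ + ∑ t ∈ Finset.univ.erase t₀, c t • e t := fun c =>
        (Finset.add_sum_erase _ _ (Finset.mem_univ t₀)).symm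
      have h4 : ∀ c : Fin K → ℂ, T t₀ O (∑ t ∈ Finset.univ.erase t₀, c t • e t) =
          ∑ t ∈ Finset.univ.erase t₀, c t • e t := by
        intro c
        rw [map_sum]
        refine Finset.sum_congr rfl fun t ht => ?_
        rw [map_smul, hfix O t₀ t (Finset.ne_of_mem_erase ht)]
      have h5 : ∑ t ∈ Finset.univ.erase t₀, (if (t : ℕ) < i then σ else 1) • e t =
          ∑ t ∈ Finset.univ.erase t₀, (if (t : ℕ) < i + 1 then σ else 1) • e t := by
        refine Finset.sum_congr rfl fun t ht => ?_
        have : (t : ℕ) ≠ i := fun h => Finset.ne_of_mem_erase ht (Fin.ext h)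
        congr 1
        by_cases h6 : (t : ℕ) < i
        · rw [if_pos h6, if_pos (by omega)]
        · rw [if_neg h6, if_neg (by omega)]
      rw [h3 fun t : Fin K => if (t : ℕ) < i then σ else 1,
        h3 fun t : Fin K => if (t : ℕ) < i + 1 then σ else 1]
      simp only [map_add, map_smul, h4, h5]
      simp only [t₀, lt_self_iff_false, if_false, one_smul, Nat.lt_succ_self, if_true]
      abel
  obtain ⟨Φ, hΦ, h⟩ := key K le_rfl
  refine ⟨Φ, hΦ, fun O => ⟨(h O).1, fun v σ η hv => ?_⟩⟩
  have h1 := (h O).2 v σ η hv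
  have h2 : ∑ t : Fin K, (if (t : ℕ) < K then σ else 1) • e t = σ • ∑ t, e t := by
    rw [Finset.smul_sum]
    exact Finset.sum_congr rfl fun t _ => by rw [if_pos t.2]
  rw [h2, map_add] at h1
  -- The catalyst is removed from the input and from the output; each removal costs `‖v‖`.
  have h3 : Φ O (∑ t, e t) - σ • ∑ t, e t =
      (Φ O (∑ t, e t) + Φ O v - (σ • ∑ t, e t + v)) + (v - Φ O v) := by abel
  rw [h3]
  refine (norm_add_le _ _).trans ?_
  have h4 := norm_sub_le v (Φ O v)
  rw [LinearIsometryEquiv.norm_map] at h4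
  linarith

/-- Reading off the sign `σ` of the previous theorem with a reference state. -/
theorem exists_impl_sign {K q : ℕ} (hK : 0 < K)
    {T : Fin K → Oracle n a → RegSpace n a W ≃ₗᵢ[ℂ] RegSpace n a W} (hT : ∀ t, Impl W q (T t))
    (e : Fin K → Reg n a W) (he : Function.Injective e)
    (hfix : ∀ O t t', t' ≠ t →
      T t O (EuclideanSpace.single (e t') 1) = EuclideanSpace.single (e t') 1)
    (r : Reg n a W) (her : ∀ t, e t ≠ r)
    (hr : ∀ O t, T t O (EuclideanSpace.single r 1) = EuclideanSpace.single r 1) :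
    ∃ Φ : Oracle n a → RegSpace n a W ≃ₗᵢ[ℂ] RegSpace n a W, Impl W (K * q) Φ ∧
      ∀ O (v : RegSpace n a W) (b : Bool) (η : ℝ),
        (∀ t, ‖T t O (EuclideanSpace.single (e t) 1 + v) -
          ((if b then (1 : ℂ) else -1) • EuclideanSpace.single (e t) 1 + v)‖ ≤ η) →
          ‖Φ O (EuclideanSpace.single r 1) -
            EuclideanSpace.single (if b then r else e ⟨0, hK⟩) 1‖ ≤
            (2 * ‖v‖ + K * η) / Real.sqrt (2 * K) := by
  obtain ⟨Φ, hΦ, h⟩ := exists_impl_product hT (fun t => EuclideanSpace.single (e t) 1) hfix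
    (EuclideanSpace.single r 1) hr
  have hK' : (0 : ℝ) < K := by exact_mod_cast hK
  set s : RegSpace n a W := ∑ t, EuclideanSpace.single (e t) 1 with hs
  have hon : Orthonormal ℂ fun t => (EuclideanSpace.single (e t) 1 : RegSpace n a W) :=
    (EuclideanSpace.orthonormal_single (𝕜 := ℂ)).comp e he
  have hsn : ‖s‖ ^ 2 = K := by
    have := hon.inner_sum (fun _ => 1) (fun _ => 1) Finset.univ
    simp only [one_smul] at this
    rw [← hs, inner_self_eq_norm_sq_to_K] at this
    have h' : ((‖s‖ ^ 2 : ℝ) : ℂ) = ((K : ℝ) : ℂ) := by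
      push_cast
      simpa using this
    exact_mod_cast h'
  have hsn' : ‖s‖ = Real.sqrt K := by rw [← hsn, Real.sqrt_sq (norm_nonneg _)]
  have hsK : (0 : ℝ) < Real.sqrt K := Real.sqrt_pos.mpr hK'
  set u : RegSpace n a W := ((Real.sqrt K)⁻¹ : ℂ) • s with hu
  have hun : ‖u‖ = 1 := by
    rw [hu, norm_smul, hsn', norm_inv, Complex.norm_real, Real.norm_of_nonneg hsK.le,
      inv_mul_cancel₀ hsK.ne']
  have hru : ⟪(EuclideanSpace.single r 1 : RegSpace n a W), u⟫_ℂ = 0 := by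
    rw [hu, hs, inner_smul_right, inner_sum]
    rw [Finset.sum_eq_zero, mul_zero]
    intro t _
    rw [EuclideanSpace.inner_single_left]
    simp [(her t).symm]
  have hb := orthonormal_sum_diff (by simp) hun hru
  set B : Bool → RegSpace n a W := fun b : Bool =>
    ((Real.sqrt 2)⁻¹ : ℂ) • (EuclideanSpace.single r 1 + (if b then (1 : ℂ) else -1) • u) with hB
  -- `g` takes `(r + u) / √2` to `r` and `(r - u) / √2` to the first clock state. Starting from `r`,
  -- the inverse of `g` prepares the former and `Φ` turns it approximately into the one with the
  -- sign to be read.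
  obtain ⟨g, hg⟩ := exists_isometry_of_orthonormal hb
    ((EuclideanSpace.orthonormal_single (𝕜 := ℂ)).comp (fun b : Bool => if b then r else e ⟨0, hK⟩)
      (by
        intro b b'
        have := her ⟨0, hK⟩
        have := this.symm
        cases b <;> cases b' <;> simp_all))
  refine ⟨_, by simpa using (Impl.gate g.symm).comp (hΦ.comp (Impl.gate g)), ?_⟩
  intro O v b η hv
  have h1 := (h O).2 v _ η hv
  have hgt : g.symm (EuclideanSpace.single r 1) = B true := by
    rw [LinearIsometryEquiv.symm_apply_eq]
    exact (hg true).symm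
  have hgb : EuclideanSpace.single (if b then r else e ⟨0, hK⟩) (1 : ℂ) = g (B b) := (hg b).symm
  simp only [LinearIsometryEquiv.trans_apply]
  rw [hgb, hgt, ← map_sub, LinearIsometryEquiv.norm_map]
  have h2 : Φ O (B true) - B b = ((Real.sqrt (2 * K))⁻¹ : ℂ) •
      (Φ O s - (if b then (1 : ℂ) else -1) • s) := by
    have h3 : ((Real.sqrt (2 * K) : ℝ) : ℂ) = (Real.sqrt 2 : ℝ) * (Real.sqrt K : ℝ) := by
      rw [Real.sqrt_mul (by norm_num)]
      push_cast
      rfl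
    rw [h3]
    simp only [hB, hu, if_true, one_smul, map_smul, map_add, (h O).1]
    rw [mul_inv, ← smul_smul, smul_sub, ← smul_sub, smul_comm (if b = true then (1 : ℂ) else -1)]
    congr 1
    abel
  rw [h2, norm_smul, norm_inv, Complex.norm_real, Real.norm_of_nonneg (Real.sqrt_nonneg _),
    div_eq_inv_mul]
  gcongr

end

/-! ### The operators of the threshold walk -/

/-- A real symmetric operator that mixes every coordinate with at most one other one. -/
noncomputable def pairIso {I : Type*} [Fintype I] {π : I → I} (hπ : Function.Involutive π)
    {α β : I → ℝ} (h₁ : ∀ i, α i ^ 2 + β i ^ 2 = 1) (h₂ : ∀ i, β (π i) = β i)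
    (h₃ : ∀ i, α (π i) * β i = -(α i * β i)) :
    EuclideanSpace ℂ I ≃ₗᵢ[ℂ] EuclideanSpace ℂ I :=
  LinearIsometry.toLinearIsometryEquiv
    { toFun := fun v => WithLp.toLp 2 fun i => (α i : ℂ) * v i + (β i : ℂ) * v (π i)
      map_add' := fun u v => by ext i; simp; ring
      map_smul' := fun r v => by ext i; simp; ring
      norm_map' := fun v => by
        refine (sq_eq_sq₀ (norm_nonneg _) (norm_nonneg _)).mp ?_
        rw [EuclideanSpace.norm_sq_eq, EuclideanSpace.norm_sq_eq]
        have expand : ∀ i, ‖(α i : ℂ) * v i + (β i : ℂ) * v (π i)‖ ^ 2 =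
            α i ^ 2 * ‖v i‖ ^ 2 + β i ^ 2 * ‖v (π i)‖ ^ 2 +
              2 * (α i * β i * ((v i).re * (v (π i)).re + (v i).im * (v (π i)).im)) := by
          intro i
          simp only [← Complex.normSq_eq_norm_sq, Complex.normSq_apply, Complex.add_re,
            Complex.add_im, Complex.re_ofReal_mul, Complex.im_ofReal_mul]
          ring
        have hre : ∀ f : I → ℝ, ∑ i, f (π i) = ∑ i, f i := fun f =>
          Equiv.sum_comp (hπ.toPerm π) f
        -- By `h₂` and `h₃` the cross terms change sign under `π`, so their sum equals its own
        -- negative.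
        have cross : ∑ i, 2 * (α i * β i * ((v i).re * (v (π i)).re + (v i).im * (v (π i)).im))
            = 0 := by
          have h := hre fun i =>
            2 * (α i * β i * ((v i).re * (v (π i)).re + (v i).im * (v (π i)).im))
          have h' : ∑ i, 2 * (α (π i) * β (π i) *
              ((v (π i)).re * (v (π (π i))).re + (v (π i)).im * (v (π (π i))).im)) =
              -∑ i, 2 * (α i * β i * ((v i).re * (v (π i)).re + (v i).im * (v (π i)).im)) := by
            rw [← Finset.sum_neg_distrib]
            refine Finset.sum_congr rfl fun i _ => ?_
            rw [hπ i, h₂, h₃]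
            ring
          rw [h'] at h
          linarith
        have diag : ∑ i, β i ^ 2 * ‖v (π i)‖ ^ 2 = ∑ i, β i ^ 2 * ‖v i‖ ^ 2 := by
          rw [← hre fun i => β i ^ 2 * ‖v i‖ ^ 2]
          simp only [h₂]
        change ∑ i, ‖(α i : ℂ) * v i + (β i : ℂ) * v (π i)‖ ^ 2 = _
        simp only [expand]
        rw [Finset.sum_add_distrib, Finset.sum_add_distrib, cross, diag, add_zero,
          ← Finset.sum_add_distrib]
        refine Finset.sum_congr rfl fun i _ => ?_
        rw [← add_mul, h₁, one_mul] } rfl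

theorem pairIso_apply {I : Type*} [Fintype I] {π : I → I} (hπ : Function.Involutive π)
    {α β : I → ℝ} (h₁ : ∀ i, α i ^ 2 + β i ^ 2 = 1) (h₂ : ∀ i, β (π i) = β i)
    (h₃ : ∀ i, α (π i) * β i = -(α i * β i)) (v : EuclideanSpace ℂ I) (i : I) :
    pairIso hπ h₁ h₂ h₃ v i = (α i : ℂ) * v i + (β i : ℂ) * v (π i) := rfl

/-- The reflection that negates the image of `u` under an isometry `h`. -/
noncomputable def conjReflection {E : Type*} [NormedAddCommGroup E] [InnerProductSpace ℂ E]
    [FiniteDimensional ℂ E] (h : E ≃ₗᵢ[ℂ] E) (u : E) : E ≃ₗᵢ[ℂ] E :=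
  h.symm.trans ((Submodule.reflection (ℂ ∙ u)ᗮ).trans h)

theorem conjReflection_of_inner_eq_zero {E : Type*} [NormedAddCommGroup E] [InnerProductSpace ℂ E]
    [FiniteDimensional ℂ E] (h : E ≃ₗᵢ[ℂ] E) (u v : E) (huv : ⟪h u, v⟫_ℂ = 0) :
    conjReflection h u v = v := by
  simp only [conjReflection, LinearIsometryEquiv.trans_apply]
  rw [Submodule.reflection_mem_subspace_eq_self, LinearIsometryEquiv.apply_symm_apply]
  rw [Submodule.mem_orthogonal_singleton_iff_inner_right, ← h.inner_map_map,
    LinearIsometryEquiv.apply_symm_apply, huv]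

theorem conjReflection_self {E : Type*} [NormedAddCommGroup E] [InnerProductSpace ℂ E]
    [FiniteDimensional ℂ E] (h : E ≃ₗᵢ[ℂ] E) (u : E) :
    conjReflection h u (h u) = -h u := by
  simp only [conjReflection, LinearIsometryEquiv.trans_apply, LinearIsometryEquiv.symm_apply_apply]
  rw [Submodule.reflection_orthogonalComplement_singleton_eq_neg, map_neg]

/-- The work register of the threshold walk: a clock with an additional reference state, or a site
of the walk together with a label `x`. -/
abbrev WalkWork (n K L : ℕ) : Type := Option (Fin K) ⊕ (Fin (2 * L + 2) × Bits n)

/-! ### States of the walk and their inner products -/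

section
set_option synthInstance.maxSize 1000
variable {n a K L : ℕ}

/-- The basis state of the clock at time `t`, or the reference state. -/
def clockState (n a L : ℕ) {K : ℕ} (t : Option (Fin K)) : Reg n a (WalkWork n K L) :=
  (false, (zeroBits n, zeroBits a), .inl t)

/-- The state with the components `c j x true • φ` and `c j x false • φ` on the basis states of the
oracle register whose first part is, respectively is not, the label `x`. -/
noncomputable def siteVec (K L : ℕ) (φ : OracleBits n a → ℂ) (c : ℕ → Bits n → Bool → ℝ) :
    RegSpace n a (WalkWork n K L) :=
  WithLp.toLp 2 fun s => match s with
    | (true, p, .inr (j, x)) => (c j x (decide (p.1 = x)) : ℂ) * φ p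
    | _ => 0

/-- The image of the all-zero state under the oracle. -/
noncomputable def oracleState (O : Oracle n a) : OracleBits n a → ℂ := fun p =>
  (O : Matrix (OracleBits n a) (OracleBits n a) ℂ) p (zeroBits n, zeroBits a)

/-- The probability of the label `x` in a state. -/
noncomputable def labelProb (φ : OracleBits n a → ℂ) (x : Bits n) : ℝ := ∑ z, ‖φ (x, z)‖ ^ 2

theorem sum_norm_oracleState (O : Oracle n a) : ∑ p, ‖oracleState O p‖ ^ 2 = 1 := by
  have h := (unitaryIso O).norm_map (EuclideanSpace.single (zeroBits n, zeroBits a) 1)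
  have h2 : ‖unitaryIso O (EuclideanSpace.single (zeroBits n, zeroBits a) 1)‖ ^ 2 = 1 := by
    rw [h]; simp
  rw [EuclideanSpace.norm_sq_eq] at h2
  rw [← h2]
  refine Finset.sum_congr rfl fun p _ => ?_
  rw [ofLp_unitaryIso]
  congr 2
  simp [oracleState]

theorem sum_labelProb (O : Oracle n a) : ∑ x, labelProb (oracleState O) x = 1 := by
  rw [← sum_norm_oracleState O, Fintype.sum_prod_type]
  rfl

theorem labelProb_nonneg (φ : OracleBits n a → ℂ) (x : Bits n) : 0 ≤ labelProb φ x :=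
  Finset.sum_nonneg fun _ _ => by positivity

theorem sum_mul_norm_oracleState (O : Oracle n a) (x : Bits n) (f : Bool → ℝ) :
    ∑ p, f (decide (p.1 = x)) * ‖oracleState O p‖ ^ 2 =
      f true * labelProb (oracleState O) x + f false * (1 - labelProb (oracleState O) x) := by
  have h1 : ∀ p : OracleBits n a, f (decide (p.1 = x)) * ‖oracleState O p‖ ^ 2 =
      f false * ‖oracleState O p‖ ^ 2 +
        if p.1 = x then (f true - f false) * ‖oracleState O p‖ ^ 2 else 0 := by
    intro p
    by_cases h : p.1 = x <;> simp [h]; ring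
  simp only [h1]
  rw [Finset.sum_add_distrib, ← Finset.mul_sum, sum_norm_oracleState, Fintype.sum_prod_type]
  have h2 : ∑ y, ∑ z, (if ((y, z) : OracleBits n a).1 = x then
      (f true - f false) * ‖oracleState O (y, z)‖ ^ 2 else 0) =
      (f true - f false) * labelProb (oracleState O) x := by
    rw [Finset.sum_eq_single x]
    · simp [labelProb, Finset.mul_sum]
    · intro y _ hy
      simp [hy]
    · simp
  rw [h2]
  ring

theorem Generates.labelProb_eq {O : Oracle n a} {α : Bits n → ℂ}
    {ψ : Bits n → EuclideanSpace ℂ (Bits a)} (h : Generates O α ψ) (x : Bits n) :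
    labelProb (oracleState O) x = ‖α x‖ ^ 2 := by
  have h1 : oracleState O = fun p => α p.1 * ψ p.1 p.2 := by
    rw [← h.2]
    ext p
    simp [oracleState]
  have h2 : ‖ψ x‖ ^ 2 = 1 := by rw [h.1 x]; norm_num
  rw [EuclideanSpace.norm_sq_eq] at h2
  simp only [labelProb, h1, norm_mul, mul_pow]
  rw [← Finset.mul_sum, h2, mul_one]

/-- For fixed `x` the two parts of `φ` have disjoint supports and squared norms `Y x` and `1 - Y x`.
This reduces all geometry of the walk to real coefficients with these weights. -/
theorem inner_siteVec (O : Oracle n a) (c d : ℕ → Bits n → Bool → ℝ) :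
    ⟪siteVec K L (oracleState O) c, siteVec K L (oracleState O) d⟫_ℂ =
      ((∑ j ∈ Finset.range (2 * L + 2), ∑ x,
        (c j x true * d j x true * labelProb (oracleState O) x +
          c j x false * d j x false * (1 - labelProb (oracleState O) x)) : ℝ) : ℂ) := by
  rw [PiLp.inner_apply, Fintype.sum_prod_type, Fintype.sum_bool]
  have h0 : ∑ q : OracleBits n a × WalkWork n K L,
      ⟪siteVec K L (oracleState O) c (false, q), siteVec K L (oracleState O) d (false, q)⟫_ℂ
        = 0 := Finset.sum_eq_zero fun q _ => by simp [siteVec]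
  rw [h0, add_zero, Fintype.sum_prod_type, Finset.sum_comm, Fintype.sum_sum_type]
  have h1 : ∑ w : Option (Fin K), ∑ p : OracleBits n a,
      ⟪siteVec K L (oracleState O) c (true, p, .inl w),
        siteVec K L (oracleState O) d (true, p, .inl w)⟫_ℂ = 0 :=
    Finset.sum_eq_zero fun q _ => Finset.sum_eq_zero fun p _ => by simp [siteVec]
  rw [h1, zero_add, Fintype.sum_prod_type, Complex.ofReal_sum, Finset.sum_range]
  refine Finset.sum_congr rfl fun j _ => ?_
  rw [Complex.ofReal_sum]
  refine Finset.sum_congr rfl fun x _ => ?_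
  rw [← sum_mul_norm_oracleState O x fun b => c j x b * d j x b, Complex.ofReal_sum]
  refine Finset.sum_congr rfl fun p _ => ?_
  simp only [siteVec, RCLike.inner_apply, map_mul, Complex.conj_ofReal]
  push_cast
  rw [← Complex.mul_conj']
  ring

theorem norm_sq_siteVec (O : Oracle n a) (c : ℕ → Bits n → Bool → ℝ) :
    ‖siteVec K L (oracleState O) c‖ ^ 2 =
      ∑ j ∈ Finset.range (2 * L + 2), ∑ x, (c j x true ^ 2 * labelProb (oracleState O) x +
        c j x false ^ 2 * (1 - labelProb (oracleState O) x)) := by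
  have h := inner_siteVec (K := K) (L := L) O c c
  rw [inner_self_eq_norm_sq_to_K] at h
  have h' : ((‖siteVec K L (oracleState O) c‖ ^ 2 : ℝ) : ℂ) = _ := (by push_cast; exact h)
  rw [Complex.ofReal_inj] at h'
  rw [h']
  simp only [pow_two]

theorem siteVec_add (φ : OracleBits n a → ℂ) (c d : ℕ → Bits n → Bool → ℝ) :
    siteVec K L φ (c + d) = siteVec K L φ c + siteVec K L φ d := by
  ext ⟨b, p, w⟩
  rcases b with _ | _ <;> rcases w with w | ⟨j, x⟩ <;> simp [siteVec, add_mul]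

theorem siteVec_smul (φ : OracleBits n a → ℂ) (r : ℝ) (c : ℕ → Bits n → Bool → ℝ) :
    siteVec K L φ (r • c) = (r : ℂ) • siteVec K L φ c := by
  ext ⟨b, p, w⟩
  rcases b with _ | _ <;> rcases w with w | ⟨j, x⟩ <;> simp [siteVec, mul_assoc]

theorem siteVec_congr (φ : OracleBits n a → ℂ) {c d : ℕ → Bits n → Bool → ℝ}
    (h : ∀ j < 2 * L + 2, c j = d j) : siteVec K L φ c = siteVec K L φ d := by
  ext ⟨b, p, w⟩
  rcases b with _ | _ <;> rcases w with w | ⟨j, x⟩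
  iterate 3 rfl
  simp [siteVec, h j j.2]

theorem inner_clockState_siteVec (t : Option (Fin K)) (φ : OracleBits n a → ℂ)
    (c : ℕ → Bits n → Bool → ℝ) :
    ⟪(EuclideanSpace.single (clockState n a L t) 1 : RegSpace n a _), siteVec K L φ c⟫_ℂ = 0 := by
  rw [EuclideanSpace.inner_single_left]
  simp [clockState, siteVec]

end

/-! ### The reflections of the walk in coefficients -/

section
set_option synthInstance.maxSize 1000
variable {n a K L : ℕ}

/-- Exchanges the labels `0` and `p.1`, where `p` is the content of the oracle register. -/
def labelSwap : Reg n a (WalkWork n K L) → Reg n a (WalkWork n K L)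
  | (true, p, .inr (j, x)) => (true, p, .inr (j, Equiv.swap (zeroBits n) p.1 x))
  | s => s

theorem labelSwap_involutive :
    Function.Involutive (labelSwap : Reg n a (WalkWork n K L) → Reg n a (WalkWork n K L)) := by
  rintro ⟨b, p, w⟩
  rcases b with _ | _ <;> rcases w with w | ⟨j, x⟩ <;> simp [labelSwap]

/-- The isometry `labelSwap`. -/
noncomputable def labelSwapIso (n a K L : ℕ) :
    RegSpace n a (WalkWork n K L) ≃ₗᵢ[ℂ] RegSpace n a (WalkWork n K L) :=
  permIso (labelSwap_involutive.toPerm _)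

theorem labelSwapIso_apply (v : RegSpace n a (WalkWork n K L)) (s : Reg n a (WalkWork n K L)) :
    labelSwapIso n a K L v s = v (labelSwap s) := rfl

/-- The signs of the reflection about the all-zero state of the oracle register, alternating with
the site. -/
def zeroSign : Reg n a (WalkWork n K L) → ℝ
  | (true, p, .inr (j, _)) => (-1) ^ (j : ℕ) * if p = (zeroBits n, zeroBits a) then 1 else -1
  | _ => 1

/-- The diagonal isometry with the entries `zeroSign`. -/
noncomputable def zeroSignIso (n a K L : ℕ) :
    RegSpace n a (WalkWork n K L) ≃ₗᵢ[ℂ] RegSpace n a (WalkWork n K L) :=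
  pairIso (π := id) (show Function.Involutive id from fun _ => rfl) (α := zeroSign) (β := 0)
    (by
      rintro ⟨b, p, w⟩
      rcases b with _ | _ <;> rcases w with w | ⟨j, x⟩ <;> simp [zeroSign]
      exact neg_one_pow_eq_or ℝ _)
    (fun _ => rfl) (by simp)

theorem zeroSignIso_apply (v : RegSpace n a (WalkWork n K L)) (s : Reg n a (WalkWork n K L)) :
    zeroSignIso n a K L v s = (zeroSign s : ℂ) * v s := by
  unfold zeroSignIso
  rw [pairIso_apply]
  simp

/-- Whether a component of a site is linked to the next site (and not to the previous one). -/
def linkedUp (j : ℕ) (b : Bool) : Bool := xor (decide (j % 2 = 0)) b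

/-- The site that is linked to the site `j`. -/
def partnerSite (j : Fin (2 * L + 2)) (b : Bool) : Fin (2 * L + 2) :=
  if linkedUp j b then (if h : (j : ℕ) + 1 < 2 * L + 2 then ⟨j + 1, h⟩ else j)
  else ⟨j - 1, by omega⟩

theorem linkedUp_succ (j : ℕ) (b : Bool) : linkedUp (j + 1) b = !linkedUp j b := by
  unfold linkedUp
  rcases Nat.mod_two_eq_zero_or_one j with h | h
  · have : (j + 1) % 2 = 1 := by omega
    cases b <;> simp [h, this]
  · have : (j + 1) % 2 = 0 := by omega
    cases b <;> simp [h, this]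

theorem partnerSite_involutive (b : Bool) :
    Function.Involutive fun j : Fin (2 * L + 2) => partnerSite j b := by
  intro j
  have hs := linkedUp_succ (j : ℕ) b
  cases hj : linkedUp (j : ℕ) b
  · have h1 : partnerSite j b = ⟨j - 1, by omega⟩ := by simp [partnerSite, hj]
    simp only [h1]
    -- Truncated subtraction makes site `0` its own partner when it has no upward link.
    rcases Nat.eq_zero_or_pos (j : ℕ) with h0 | h0
    · have : (⟨(j : ℕ) - 1, by omega⟩ : Fin (2 * L + 2)) = j := Fin.ext (by simp [h0])
      rw [this, h1, this]
    · have h2 : linkedUp ((j : ℕ) - 1) b = true := by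
        have := linkedUp_succ ((j : ℕ) - 1) b
        rw [Nat.sub_add_cancel h0, hj] at this
        simpa using this.symm
      have h3 : (j : ℕ) - 1 + 1 < 2 * L + 2 := by omega
      simp only [partnerSite, h2, if_true, dif_pos h3]
      exact Fin.ext (by simp; omega)
  · by_cases h : (j : ℕ) + 1 < 2 * L + 2
    · have h1 : partnerSite j b = ⟨j + 1, h⟩ := by simp [partnerSite, hj, h]
      simp only [h1]
      rw [hj] at hs
      simp [partnerSite, hs]
    · have h1 : partnerSite j b = j := by simp [partnerSite, hj, h]
      simp only [h1]

/-- The map of basis states to linked basis states. -/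
def partner : Reg n a (WalkWork n K L) → Reg n a (WalkWork n K L)
  | (true, p, .inr (j, x)) => (true, p, .inr (partnerSite j (decide (p.1 = x)), x))
  | s => s

theorem partner_involutive :
    Function.Involutive (partner : Reg n a (WalkWork n K L) → Reg n a (WalkWork n K L)) := by
  rintro ⟨b, p, w⟩
  rcases b with _ | _ <;> rcases w with w | ⟨j, x⟩
  iterate 3 rfl
  have := partnerSite_involutive (decide (p.1 = x)) j
  simp only at this
  simp only [partner, this]

/-- The diagonal entries of the reflection of the links. -/
noncomputable def linkDiag (t : ℝ) (j : Fin (2 * L + 2)) (b : Bool) : ℝ :=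
  if partnerSite j b = j then 1 else if linkedUp j b then 1 - 2 * t ^ 2 else -(1 - 2 * t ^ 2)

/-- The off-diagonal entries of the reflection of the links. -/
noncomputable def linkOff (t : ℝ) (j : Fin (2 * L + 2)) (b : Bool) : ℝ :=
  if partnerSite j b = j then 0 else 2 * t * Real.sqrt (1 - t ^ 2)

theorem linkedUp_partnerSite {j : Fin (2 * L + 2)} {b : Bool} (h : partnerSite j b ≠ j) :
    linkedUp (partnerSite j b) b = !linkedUp j b := by
  cases hj : linkedUp (j : ℕ) b
  · have h1 : partnerSite j b = ⟨j - 1, by omega⟩ := by simp [partnerSite, hj]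
    have h0 : 0 < (j : ℕ) := by
      by_contra h0
      exact h (h1.trans (Fin.ext (by simp; omega)))
    have := linkedUp_succ ((j : ℕ) - 1) b
    rw [Nat.sub_add_cancel h0, hj] at this
    rw [h1]
    simpa using this.symm
  · by_cases h' : (j : ℕ) + 1 < 2 * L + 2
    · have h1 : partnerSite j b = ⟨j + 1, h'⟩ := by simp [partnerSite, hj, h']
      rw [h1]
      simp [linkedUp_succ, hj]
    · exact absurd (by simp [partnerSite, hj, h']) h

/-- The reflection that fixes the vectors `(√(1 - t²), t)` on the pairs of linked components. -/
noncomputable def linkIso (n a K L : ℕ) {t : ℝ} (ht : t ^ 2 ≤ 1) :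
    RegSpace n a (WalkWork n K L) ≃ₗᵢ[ℂ] RegSpace n a (WalkWork n K L) :=
  pairIso (π := partner) partner_involutive
    (α := fun s => match s with
      | (true, p, .inr (j, x)) => linkDiag t j (decide (p.1 = x))
      | _ => 1)
    (β := fun s => match s with
      | (true, p, .inr (j, x)) => linkOff t j (decide (p.1 = x))
      | _ => 0)
    (by
      rintro ⟨b, p, w⟩
      rcases b with _ | _ <;> rcases w with w | ⟨j, x⟩
      iterate 3 simp
      have := Real.sq_sqrt (sub_nonneg.mpr ht)
      simp only [linkDiag, linkOff]
      split_ifs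
      · norm_num
      · linear_combination 4 * t ^ 2 * this
      · linear_combination 4 * t ^ 2 * this)
    (by
      rintro ⟨b, p, w⟩
      rcases b with _ | _ <;> rcases w with w | ⟨j, x⟩
      iterate 3 rfl
      have := partnerSite_involutive (decide (p.1 = x)) j
      simp only at this
      simp only [partner, linkOff, this, eq_comm (a := j)])
    (by
      rintro ⟨b, p, w⟩
      rcases b with _ | _ <;> rcases w with w | ⟨j, x⟩
      iterate 3 simp
      have := partnerSite_involutive (decide (p.1 = x)) j
      simp only at this
      simp only [partner, linkOff, linkDiag, this]
      by_cases h : partnerSite j (decide (p.1 = x)) = j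
      · simp [h]
      · rw [linkedUp_partnerSite h]
        cases linkedUp (j : ℕ) (decide (p.1 = x)) <;> simp [h, Ne.symm h] <;> ring)

/-- The action of the reflection of the links on coefficients. -/
noncomputable def linkCoeff (L : ℕ) (t : ℝ) (c : ℕ → Bits n → Bool → ℝ) :
    ℕ → Bits n → Bool → ℝ := fun j x b =>
  if linkedUp j b then
    if j + 1 < 2 * L + 2 then
      (1 - 2 * t ^ 2) * c j x b + 2 * t * Real.sqrt (1 - t ^ 2) * c (j + 1) x b
    else c j x b
  else
    if 0 < j then 2 * t * Real.sqrt (1 - t ^ 2) * c (j - 1) x b - (1 - 2 * t ^ 2) * c j x b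
    else c j x b

theorem linkIso_siteVec {t : ℝ} (ht : t ^ 2 ≤ 1) (φ : OracleBits n a → ℂ)
    (c : ℕ → Bits n → Bool → ℝ) :
    linkIso n a K L ht (siteVec K L φ c) = siteVec K L φ (linkCoeff L t c) := by
  ext ⟨b, p, w⟩
  unfold linkIso
  rw [pairIso_apply]
  rcases b with _ | _ <;> rcases w with w | ⟨j, x⟩
  iterate 3 simp [siteVec, partner]
  simp only [siteVec, partner]
  generalize decide (p.1 = x) = b
  have : (linkCoeff L t c j x b) =
      linkDiag t j b * c j x b + linkOff t j b * c (partnerSite j b) x b := by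
    unfold linkCoeff linkDiag linkOff
    cases hj : linkedUp (j : ℕ) b
    · have h1 : partnerSite j b = ⟨j - 1, by omega⟩ := by simp [partnerSite, hj]
      rcases Nat.eq_zero_or_pos (j : ℕ) with h0 | h0
      · have h2 : partnerSite j b = j := h1.trans (Fin.ext (by simp [h0]))
        simp [h2, h0]
      · have h2 : partnerSite j b ≠ j := by
          rw [h1]
          intro h
          have := congrArg Fin.val h
          simp at this
          omega
        have h3 : ((partnerSite j b : Fin _) : ℕ) = j - 1 := by rw [h1]
        rw [if_neg h2, if_neg h2, h3, if_pos h0]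
        simp only [Bool.false_eq_true, if_false]
        ring
    · by_cases h : (j : ℕ) + 1 < 2 * L + 2
      · have h1 : partnerSite j b = ⟨j + 1, h⟩ := by simp [partnerSite, hj, h]
        have h2 : partnerSite j b ≠ j := by
          rw [h1]
          intro h
          have := congrArg Fin.val h
          simp at this
        have h3 : ((partnerSite j b : Fin _) : ℕ) = j + 1 := by rw [h1]
        rw [if_neg h2, if_neg h2, h3, if_pos h, if_pos rfl, if_pos rfl]
      · have h1 : partnerSite j b = j := by simp [partnerSite, hj, h]
        simp [h1, h]
  rw [this]
  push_cast
  ring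

/-- The alternating reflections about the state generated by the oracle. -/
noncomputable def oracleReflection (K L : ℕ) (O : Oracle n a) :
    RegSpace n a (WalkWork n K L) ≃ₗᵢ[ℂ] RegSpace n a (WalkWork n K L) :=
  (ctrlIso _ O).symm.trans ((zeroSignIso n a K L).trans (ctrlIso _ O))

/-- The action of `oracleReflection` on coefficients. -/
noncomputable def reflCoeff (Y : Bits n → ℝ) (c : ℕ → Bits n → Bool → ℝ) :
    ℕ → Bits n → Bool → ℝ := fun j x b =>
  (-1) ^ j * (2 * (c j x true * Y x + c j x false * (1 - Y x)) - c j x b)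

/-- Conjugating the reflection about the all-zero state by the query gives the reflection about `φ`.
The overlap of a site's vector with `φ` is the mean of its two coefficients with weights `Y x` and
`1 - Y x`, which explains `reflCoeff`. -/
theorem oracleReflection_siteVec (O : Oracle n a) (c : ℕ → Bits n → Bool → ℝ) :
    oracleReflection K L O (siteVec K L (oracleState O) c) =
      siteVec K L (oracleState O) (reflCoeff (labelProb (oracleState O)) c) := by
  set v := siteVec K L (oracleState O) c with hv
  have hz : ctrlIso _ O ((ctrlIso _ O).symm v) = v := LinearIsometryEquiv.apply_symm_apply _ _
  set z := (ctrlIso _ O).symm v with hzdef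
  ext ⟨b, p, w⟩
  have hT : oracleReflection K L O v = ctrlIso _ O (zeroSignIso n a K L z) := rfl
  rw [hT]
  rcases b with _ | _
  · rw [ctrlIso_false, zeroSignIso_apply]
    have h := congrArg (fun f => f (false, p, w)) hz
    simp only [ctrlIso_false] at h
    rw [h]
    rcases w with w | ⟨j, x⟩ <;> simp [hv, siteVec]
  rw [ctrlIso_true]
  simp only [zeroSignIso_apply]
  have h := congrArg (fun f => f (true, p, w)) hz
  simp only [ctrlIso_true] at h
  rcases w with w | ⟨j, x⟩
  · simp only [zeroSign, Complex.ofReal_one, one_mul]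
    rw [h]
    simp [hv, siteVec]
  have h0 : z (true, (zeroBits n, zeroBits a), .inr (j, x)) =
      ((c j x true * labelProb (oracleState O) x +
        c j x false * (1 - labelProb (oracleState O) x) : ℝ) : ℂ) := by
    rw [hzdef, ctrlIso_symm, ctrlIso_true, ← sum_mul_norm_oracleState O x (c j x)]
    simp only [Matrix.mulVec, dotProduct]
    rw [Complex.ofReal_sum]
    refine Finset.sum_congr rfl fun q _ => ?_
    have : ((O⁻¹ : Oracle n a) : Matrix (OracleBits n a) (OracleBits n a) ℂ)
        (zeroBits n, zeroBits a) q = starRingEnd ℂ (oracleState O q) := rfl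
    rw [this, hv]
    simp only [siteVec]
    push_cast
    rw [← Complex.conj_mul']
    ring
  -- The signs amount to twice the projection on the all-zero state minus the identity, times `(-1)
  -- ^ j`.
  have hsplit : (fun q => (zeroSign ((true, q, .inr (j, x)) : Reg n a (WalkWork n K L)) : ℂ) *
      z (true, q, .inr (j, x))) = ((-1) ^ (j : ℕ) : ℂ) •
        (Pi.single (zeroBits n, zeroBits a) (2 * z (true, (zeroBits n, zeroBits a), .inr (j, x))) -
          fun q => z (true, q, .inr (j, x))) := by
    ext q
    simp only [zeroSign, Pi.smul_apply, Pi.sub_apply, smul_eq_mul, Pi.single_apply]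
    split_ifs with hq
    · subst hq
      push_cast
      ring
    · push_cast
      ring
  rw [hsplit, Matrix.mulVec_smul, Matrix.mulVec_sub, Pi.smul_apply, Pi.sub_apply, h, h0,
    Matrix.mulVec_single]
  simp only [hv, siteVec, reflCoeff, oracleState]
  simp
  ring

theorem ctrlIso_clockState (O : Oracle n a) (t : Option (Fin K)) :
    ctrlIso _ O (EuclideanSpace.single (clockState n a L t) 1) =
      EuclideanSpace.single (clockState n a L t) 1 := by
  ext ⟨b, p, w⟩
  cases b
  · rw [ctrlIso_false]
  · rw [ctrlIso_true]
    have : (fun q => (EuclideanSpace.single (clockState n a L t) 1 : RegSpace n a (WalkWork n K L))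
        (true, q, w)) = 0 := by
      ext q
      simp [clockState]
    rw [this, Matrix.mulVec_zero]
    simp [clockState]

theorem zeroSignIso_clockState (t : Option (Fin K)) :
    zeroSignIso n a K L (EuclideanSpace.single (clockState n a L t) 1) =
      EuclideanSpace.single (clockState n a L t) 1 := by
  ext ⟨b, p, w⟩
  rw [zeroSignIso_apply]
  rcases b with _ | _ <;> rcases w with w | ⟨j, x⟩ <;> simp [clockState, zeroSign]

theorem linkIso_clockState {r : ℝ} (hr : r ^ 2 ≤ 1) (t : Option (Fin K)) :
    linkIso n a K L hr (EuclideanSpace.single (clockState n a L t) 1) =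
      EuclideanSpace.single (clockState n a L t) 1 := by
  ext ⟨b, p, w⟩
  unfold linkIso
  rw [pairIso_apply]
  rcases b with _ | _ <;> rcases w with w | ⟨j, x⟩ <;> simp [clockState, partner]

theorem labelSwapIso_clockState (t : Option (Fin K)) :
    labelSwapIso n a K L (EuclideanSpace.single (clockState n a L t) 1) =
      EuclideanSpace.single (clockState n a L t) 1 := by
  ext ⟨b, p, w⟩
  rw [labelSwapIso_apply]
  rcases b with _ | _ <;> rcases w with w | ⟨j, x⟩ <;> simp [clockState, labelSwap]

theorem oracleReflection_clockState (O : Oracle n a) (t : Option (Fin K)) :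
    oracleReflection K L O (EuclideanSpace.single (clockState n a L t) 1) =
      EuclideanSpace.single (clockState n a L t) 1 := by
  have h : (ctrlIso _ O).symm (EuclideanSpace.single (clockState n a L t) 1) =
      EuclideanSpace.single (clockState n a L t) 1 := by
    rw [LinearIsometryEquiv.symm_apply_eq, ctrlIso_clockState]
  simp only [oracleReflection, LinearIsometryEquiv.trans_apply]
  rw [h, zeroSignIso_clockState, ctrlIso_clockState]

end

/-! ### The entry vector and the walk step -/

section
set_option synthInstance.maxSize 1000
variable {n a K L : ℕ}

/-- The coefficients of the entry state of the walk. -/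
def entryCoeff (n : ℕ) : ℕ → Bits n → Bool → ℝ := fun j _ b => if j = 0 ∧ b = true then 1 else 0

/-- The state from which a step at time `k` enters the walk, before the call of the oracle. -/
noncomputable def entryState (n a L : ℕ) (κ : ℝ) (k : Fin K) : RegSpace n a (WalkWork n K L) :=
  EuclideanSpace.single (clockState n a L (some k)) 1 +
    (κ : ℂ) • EuclideanSpace.single (true, (zeroBits n, zeroBits a), .inr (0, zeroBits n)) 1

/-- The query produces `φ`, and exchanging the blank label with the content of the oracle register
copies the outcome into the label. All labels thus enter site `0` in one superposition, and the
entry vector becomes the image of an oracle-independent one. -/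
theorem map_entryState (O : Oracle n a) (κ : ℝ) (k : Fin K) :
    ((ctrlIso _ O).trans (labelSwapIso n a K L)) (entryState n a L κ k) =
      EuclideanSpace.single (clockState n a L (some k)) 1 +
        siteVec K L (oracleState O) (κ • entryCoeff n) := by
  simp only [LinearIsometryEquiv.trans_apply, entryState, map_add, map_smul, ctrlIso_clockState,
    labelSwapIso_clockState, siteVec_smul]
  congr 2
  ext ⟨b, p, w⟩
  rw [labelSwapIso_apply]
  rcases b with _ | _
  · rcases w with w | ⟨j, x⟩ <;> simp [labelSwap, ctrlIso_false, siteVec]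
  rcases w with w | ⟨j, x⟩
  · simp only [labelSwap, ctrlIso_true]
    have : (fun q => (EuclideanSpace.single (true, (zeroBits n, zeroBits a),
        .inr (0, zeroBits n)) 1 : RegSpace n a (WalkWork n K L)) (true, q, .inl w)) = 0 := by
      ext q
      simp
    rw [this, Matrix.mulVec_zero]
    simp [siteVec]
  · simp only [labelSwap, ctrlIso_true]
    have : (fun q => (EuclideanSpace.single (true, (zeroBits n, zeroBits a),
        .inr (0, zeroBits n)) 1 : RegSpace n a (WalkWork n K L))
          (true, q, .inr (j, Equiv.swap (zeroBits n) p.1 x))) =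
        Pi.single (zeroBits n, zeroBits a) (if j = 0 ∧ p.1 = x then 1 else 0) := by
      ext q
      have hsw : Equiv.swap (zeroBits n) p.1 x = zeroBits n ↔ p.1 = x := by
        rw [Equiv.swap_apply_eq_iff, Equiv.swap_apply_left, eq_comm]
      simp only [PiLp.single_apply, Pi.single_apply, Prod.mk.injEq, Sum.inr.injEq, true_and, hsw]
      split_ifs <;> simp_all
    rw [this, Matrix.mulVec_single]
    simp only [siteVec, entryCoeff, oracleState]
    by_cases hj : j = 0 <;> by_cases hx : p.1 = x <;> simp [hj, hx]

/-- A step of the threshold walk. -/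
noncomputable def walkStep (L : ℕ) (κ : ℝ) {t : ℝ} (ht : t ^ 2 ≤ 1) (k : Fin K) (O : Oracle n a) :
    RegSpace n a (WalkWork n K L) ≃ₗᵢ[ℂ] RegSpace n a (WalkWork n K L) :=
  (conjReflection ((ctrlIso _ O).trans (labelSwapIso n a K L)) (entryState n a L κ k)).trans
    ((oracleReflection K L O).trans (linkIso n a K L ht))

/-- Each of the two oracle-dependent reflections is a fixed reflection conjugated by a query: two
calls each. -/
theorem impl_walkStep (κ : ℝ) {t : ℝ} (ht : t ^ 2 ≤ 1) (k : Fin K) :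
    Impl (n := n) (a := a) (WalkWork n K L) 4 (walkStep L κ ht k) := by
  have h := (((Impl.gate (labelSwapIso n a K L).symm).comp Impl.queryInv).comp
    ((Impl.gate (Submodule.reflection (ℂ ∙ entryState n a L κ k)ᗮ)).comp
      (Impl.query.comp (Impl.gate (labelSwapIso n a K L))))).comp
    ((Impl.queryInv.comp ((Impl.gate (zeroSignIso n a K L)).comp Impl.query)).comp
      (Impl.gate (linkIso n a K L ht)))
  have heq : ∀ O, ((ctrlIso (WalkWork n K L) O).trans (labelSwapIso n a K L)).symm =
      (labelSwapIso n a K L).symm.trans (ctrlIso (WalkWork n K L) O).symm := fun O => by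
    ext1 v
    rw [LinearIsometryEquiv.symm_apply_eq]
    simp only [LinearIsometryEquiv.trans_apply, LinearIsometryEquiv.apply_symm_apply]
  unfold walkStep conjReflection oracleReflection
  simp only [heq]
  exact h

theorem walkStep_of_inner_eq_zero {κ t : ℝ} (ht : t ^ 2 ≤ 1) (k : Fin K) (O : Oracle n a)
    (v : RegSpace n a (WalkWork n K L))
    (hv : ⟪EuclideanSpace.single (clockState n a L (some k)) 1 +
        siteVec K L (oracleState O) (κ • entryCoeff n), v⟫_ℂ = 0) :
    walkStep L κ ht k O v = linkIso n a K L ht (oracleReflection K L O v) := by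
  simp only [walkStep, LinearIsometryEquiv.trans_apply]
  rw [conjReflection_of_inner_eq_zero]
  rw [map_entryState]
  exact hv

theorem walkStep_clockState {κ t : ℝ} (ht : t ^ 2 ≤ 1) (k : Fin K) (O : Oracle n a)
    (s : Option (Fin K)) (hs : s ≠ some k) :
    walkStep L κ ht k O (EuclideanSpace.single (clockState n a L s) 1) =
      EuclideanSpace.single (clockState n a L s) 1 := by
  rw [walkStep_of_inner_eq_zero, oracleReflection_clockState, linkIso_clockState]
  rw [inner_add_left, inner_eq_zero_symm.mp (inner_clockState_siteVec _ _ _),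
    EuclideanSpace.inner_single_left]
  simp [clockState, hs.symm]

theorem inner_clockState_self (s : Option (Fin K)) :
    ⟪(EuclideanSpace.single (clockState n a L s) 1 : RegSpace n a (WalkWork n K L)),
      EuclideanSpace.single (clockState n a L s) 1⟫_ℂ = 1 := by
  rw [EuclideanSpace.inner_single_left]
  simp

theorem inner_entryCoeff (O : Oracle n a) (κ : ℝ) (c : ℕ → Bits n → Bool → ℝ) :
    ⟪siteVec K L (oracleState O) (κ • entryCoeff n), siteVec K L (oracleState O) c⟫_ℂ =
      ((κ * ∑ x, c 0 x true * labelProb (oracleState O) x : ℝ) : ℂ) := by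
  rw [inner_siteVec, Finset.sum_eq_single 0]
  · congr 1
    rw [Finset.mul_sum]
    refine Finset.sum_congr rfl fun x _ => ?_
    simp [entryCoeff]
    ring
  · intro j _ hj
    refine Finset.sum_eq_zero fun x _ => ?_
    simp [entryCoeff, hj]
  · simp

/-- Coefficients of a vector that is left invariant, together with the clock state. -/
theorem walkStep_invariant {κ t : ℝ} (ht : t ^ 2 ≤ 1) (k : Fin K) (O : Oracle n a)
    {c : ℕ → Bits n → Bool → ℝ}
    (hc : κ * ∑ x, c 0 x true * labelProb (oracleState O) x = -1)
    (hr : ∀ j < 2 * L + 2, reflCoeff (labelProb (oracleState O)) c j = c j)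
    (hl : ∀ j < 2 * L + 2, linkCoeff L t c j = c j) :
    walkStep L κ ht k O (EuclideanSpace.single (clockState n a L (some k)) 1 +
        siteVec K L (oracleState O) c) =
      EuclideanSpace.single (clockState n a L (some k)) 1 + siteVec K L (oracleState O) c := by
  rw [walkStep_of_inner_eq_zero, map_add, map_add, oracleReflection_clockState, linkIso_clockState,
    oracleReflection_siteVec, siteVec_congr _ hr, linkIso_siteVec, siteVec_congr _ hl]
  rw [inner_add_left, inner_add_right, inner_add_right, inner_clockState_self,
    inner_clockState_siteVec, inner_eq_zero_symm.mp (inner_clockState_siteVec _ _ _),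
    inner_entryCoeff, hc]
  norm_num

/-- Coefficients of a vector for which the clock state is negated. -/
theorem walkStep_negate {κ t : ℝ} (ht : t ^ 2 ≤ 1) (k : Fin K) (O : Oracle n a)
    {z : ℕ → Bits n → Bool → ℝ} (h0 : ∀ x, z 0 x true = -κ)
    (hr : ∀ j < 2 * L + 2, reflCoeff (labelProb (oracleState O)) z j = -z j) :
    walkStep L κ ht k O (EuclideanSpace.single (clockState n a L (some k)) 1 +
        siteVec K L (oracleState O) (z + (2 * κ) • entryCoeff n)) =
      -EuclideanSpace.single (clockState n a L (some k)) 1 +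
        siteVec K L (oracleState O) (linkCoeff L t (-z)) := by
  set e : RegSpace n a (WalkWork n K L) :=
    EuclideanSpace.single (clockState n a L (some k)) 1 with he
  set φ := oracleState O with hφ
  -- The first summand is the entry vector, which is negated. The second is orthogonal to it,
  -- because `h0` cancels its coefficients on the entry, and is kept.
  have hsplit : e + siteVec K L φ (z + (2 * κ) • entryCoeff n) =
      (e + siteVec K L φ (κ • entryCoeff n)) + siteVec K L φ (z + κ • entryCoeff n) := by
    rw [siteVec_add, siteVec_add, siteVec_smul, siteVec_smul]
    push_cast
    module
  have h1 : walkStep L κ ht k O (e + siteVec K L φ (κ • entryCoeff n)) =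
      -linkIso n a K L ht (oracleReflection K L O (e + siteVec K L φ (κ • entryCoeff n))) := by
    simp only [walkStep, LinearIsometryEquiv.trans_apply]
    rw [he, hφ, ← map_entryState, conjReflection_self]
    simp only [map_neg]
  have h2 : walkStep L κ ht k O (siteVec K L φ (z + κ • entryCoeff n)) =
      linkIso n a K L ht (oracleReflection K L O (siteVec K L φ (z + κ • entryCoeff n))) := by
    apply walkStep_of_inner_eq_zero
    rw [inner_add_left, inner_clockState_siteVec, inner_entryCoeff]
    simp [entryCoeff, h0]
  have h3 : -(e + siteVec K L φ (κ • entryCoeff n)) + siteVec K L φ (z + κ • entryCoeff n) =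
      -e + siteVec K L φ z := by
    rw [siteVec_add]
    abel
  rw [hsplit, map_add, h1, h2, ← map_neg, ← map_neg, ← map_add, ← map_add, h3, map_add, map_add,
    map_neg, map_neg, oracleReflection_clockState, linkIso_clockState, oracleReflection_siteVec,
    siteVec_congr (d := -z) _ hr, linkIso_siteVec]

end

/-! ### Catalysts of the threshold walk -/

theorem sum_range_two_mul (f : ℕ → ℝ) (m : ℕ) :
    ∑ j ∈ Finset.range (2 * m), f j = ∑ k ∈ Finset.range m, (f (2 * k) + f (2 * k + 1)) := by
  induction m with
  | zero => simp
  | succ m ih =>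
    rw [Finset.sum_range_succ, ← ih, Nat.mul_succ, Finset.sum_range_succ, Finset.sum_range_succ]
    ring

/-- Squares of numbers in `[0, 1]` only shrink, so the plain geometric series suffices. -/
theorem geom_sum_sq_le {q : ℝ} (h0 : 0 ≤ q) (h1 : q < 1) (m : ℕ) :
    ∑ k ∈ Finset.range m, (q ^ k) ^ 2 ≤ 1 / (1 - q) := by
  have h : ∑ k ∈ Finset.range m, (q ^ k) ^ 2 ≤ ∑ k ∈ Finset.range m, q ^ k :=
    Finset.sum_le_sum fun k _ => by
      have := pow_le_one₀ (n := k) h0 h1.le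
      have := pow_nonneg h0 k
      nlinarith
  refine h.trans ?_
  rw [le_div_iff₀ (by linarith), geom_sum_mul_neg]
  linarith [pow_nonneg h0 m]

section
variable {n a K L : ℕ}

/-- The coefficients of the catalyst if the label `x₀` has a large probability. -/
noncomputable def largeCoeff (x₀ : Bits n) (A c s : ℝ) : ℕ → Bits n → Bool → ℝ := fun j x b =>
  if x = x₀ then
    A * (-(c ^ 2 * s)) ^ (j / 2) * (if j % 2 = 0 then 1 else if b then -(c * s) else c)
  else 0

/-- The coefficients of the catalyst, except for a sign of the entry state, if all labels have a
small probability. -/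
noncomputable def smallCoeff (A c : ℝ) (g : Bits n → ℝ) : ℕ → Bits n → Bool → ℝ := fun j x b =>
  A * (-(g x / c ^ 2)) ^ (j / 2) * (if j % 2 = 0 then (if b then 1 else -g x) else g x / c)

/-- At even sites the vector is a multiple of `φ`; at odd sites, where the sign is reversed, `hs`
makes it orthogonal to `φ`. -/
theorem reflCoeff_largeCoeff {Y : Bits n → ℝ} {x₀ : Bits n} {s : ℝ} (hs : s * Y x₀ = 1 - Y x₀)
    (A c : ℝ) : reflCoeff Y (largeCoeff x₀ A c s) = largeCoeff x₀ A c s := by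
  funext j x b
  by_cases hx : x = x₀
  · subst hx
    obtain ⟨k, rfl | rfl⟩ := j.even_or_odd'
    · simp [reflCoeff, largeCoeff, pow_mul]
      ring
    · have h1 : (2 * k + 1) / 2 = k := by omega
      have h2 : (2 * k + 1) % 2 = 1 := by omega
      have h3 : (-1 : ℝ) ^ (2 * k + 1) = -1 := by rw [pow_succ, pow_mul]; norm_num
      cases b
      · simp only [reflCoeff, largeCoeff, h1, h2, h3, if_true, one_ne_zero, if_false,
          Bool.false_eq_true]
        linear_combination (2 * A * c * (-(c ^ 2 * s)) ^ k) * hs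
      · simp only [reflCoeff, largeCoeff, h1, h2, h3, if_true, one_ne_zero, if_false,
          Bool.false_eq_true]
        linear_combination (2 * A * c * (-(c ^ 2 * s)) ^ k) * hs
  · simp [reflCoeff, largeCoeff, hx]

/-- The roles of the sites are exchanged: orthogonal to `φ` at even ones by `hg`, parallel to `φ` at
odd ones. -/
theorem reflCoeff_smallCoeff {Y : Bits n → ℝ} {g : Bits n → ℝ} (hg : ∀ x, g x * (1 - Y x) = Y x)
    (A c : ℝ) : reflCoeff Y (smallCoeff A c g) = -smallCoeff A c g := by
  funext j x b
  have hgx := hg x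
  obtain ⟨k, rfl | rfl⟩ := j.even_or_odd'
  · have h1 : (2 * k) / 2 = k := by omega
    have h2 : (2 * k) % 2 = 0 := by omega
    have h3 : (-1 : ℝ) ^ (2 * k) = 1 := by rw [pow_mul]; norm_num
    simp only [reflCoeff, smallCoeff, h1, h2, h3, if_true, Pi.neg_apply, if_false,
      Bool.false_eq_true]
    linear_combination (-2 * A * (-(g x / c ^ 2)) ^ k) * hgx
  · have h1 : (2 * k + 1) / 2 = k := by omega
    have h2 : (2 * k + 1) % 2 = 1 := by omega
    have h3 : (-1 : ℝ) ^ (2 * k + 1) = -1 := by rw [pow_succ, pow_mul]; norm_num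
    simp only [reflCoeff, smallCoeff, h1, h2, h3, one_ne_zero, Pi.neg_apply, if_false]
    ring

/-- By `h₁` and `h₂` the link reflection fixes `(1, c)`, and `c` is the ratio of the coefficients
across every link. The unlinked components at both ends are fixed anyway, so cutting the line off
causes no error. -/
theorem linkCoeff_largeCoeff {t c : ℝ}
    (h₁ : (1 - 2 * t ^ 2) + 2 * t * Real.sqrt (1 - t ^ 2) * c = 1)
    (h₂ : 2 * t * Real.sqrt (1 - t ^ 2) - (1 - 2 * t ^ 2) * c = c) (x₀ : Bits n) (A s : ℝ) :
    linkCoeff L t (largeCoeff x₀ A c s) = largeCoeff x₀ A c s := by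
  funext j x b
  by_cases hx : x = x₀
  · subst hx
    unfold linkCoeff
    generalize 2 * t * Real.sqrt (1 - t ^ 2) = S at *
    generalize 1 - 2 * t ^ 2 = D at *
    obtain ⟨k, rfl | rfl⟩ := j.even_or_odd'
    · have e1 : (2 * k) / 2 = k := by omega
      have e2 : (2 * k) % 2 = 0 := by omega
      cases b
      · have e3 : (2 * k + 1) / 2 = k := by omega
        have e4 : (2 * k + 1) % 2 = 1 := by omega
        split_ifs with u v w <;> simp only [linkedUp, e2] at u <;> try simp at u
        · simp only [largeCoeff, e1, e2, e3, e4, if_true, one_ne_zero, if_false,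
            Bool.false_eq_true]
          linear_combination (A * (-(c ^ 2 * s)) ^ k) * h₁
        · rfl
      · split_ifs with u v w <;> simp only [linkedUp, e2] at u <;> try simp at u
        · obtain ⟨l, rfl⟩ : ∃ l, k = l + 1 := ⟨k - 1, by omega⟩
          have e3 : (2 * (l + 1) - 1) / 2 = l := by omega
          have e4 : (2 * (l + 1) - 1) % 2 = 1 := by omega
          simp only [largeCoeff, e1, e2, e3, e4, if_true, one_ne_zero, if_false, pow_succ]
          linear_combination (-(A * (-(c ^ 2 * s)) ^ l * c * s)) * h₂
        · rfl
    · have e1 : (2 * k + 1) / 2 = k := by omega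
      have e2 : (2 * k + 1) % 2 = 1 := by omega
      cases b
      · have e3 : (2 * k + 1 - 1) / 2 = k := by omega
        have e4 : (2 * k + 1 - 1) % 2 = 0 := by omega
        split_ifs with u v w <;> simp only [linkedUp, e2] at u <;> try simp at u
        · simp only [largeCoeff, e1, e2, e3, e4, if_true, one_ne_zero, if_false,
            Bool.false_eq_true]
          linear_combination (A * (-(c ^ 2 * s)) ^ k) * h₂
        · omega
      · have e3 : (2 * k + 1 + 1) / 2 = k + 1 := by omega
        have e4 : (2 * k + 1 + 1) % 2 = 0 := by omega
        split_ifs with u v w <;> simp only [linkedUp, e2] at u <;> try simp at u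
        · simp only [largeCoeff, e1, e2, e3, e4, if_true, one_ne_zero, if_false, pow_succ]
          linear_combination (-(A * (-(c ^ 2 * s)) ^ k * c * s)) * h₁
        · rfl
  · simp [linkCoeff, largeCoeff, hx]

/-- The ratio across every link is `-1 / c`, so linked pairs are orthogonal to the fixed vector `(1,
c)` and are negated. The two unlinked components stay fixed and get the opposite sign. The one at
site `0` is repaired by the entry vector; the one at the last site is the truncation error. -/
theorem linkCoeff_neg_smallCoeff {t c : ℝ} (hc : c ≠ 0)
    (h₁ : (1 - 2 * t ^ 2) + 2 * t * Real.sqrt (1 - t ^ 2) * c = 1)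
    (h₂ : 2 * t * Real.sqrt (1 - t ^ 2) - (1 - 2 * t ^ 2) * c = c) (A : ℝ) (g : Bits n → ℝ)
    (j : ℕ) (hj : j < 2 * L + 2) (x : Bits n) (b : Bool) :
    linkCoeff L t (-smallCoeff A c g) j x b =
      if (j = 0 ∨ j = 2 * L + 1) ∧ b = true then -smallCoeff A c g j x b
      else smallCoeff A c g j x b := by
  unfold linkCoeff
  generalize 2 * t * Real.sqrt (1 - t ^ 2) = S at *
  generalize 1 - 2 * t ^ 2 = D at *
  obtain ⟨k, rfl | rfl⟩ := j.even_or_odd'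
  · have e1 : (2 * k) / 2 = k := by omega
    have e2 : (2 * k) % 2 = 0 := by omega
    cases b
    · have e3 : (2 * k + 1) / 2 = k := by omega
      have e4 : (2 * k + 1) % 2 = 1 := by omega
      have u : linkedUp (2 * k) false = true := by simp [linkedUp]
      have v : 2 * k + 1 < 2 * L + 2 := by omega
      rw [if_pos u, if_pos v, if_neg (by simp)]
      simp only [Pi.neg_apply, smallCoeff, e1, e2, e3, e4, if_true, one_ne_zero, if_false,
        Bool.false_eq_true]
      field_simp
      linear_combination (-(A * g x * (-(g x / c ^ 2)) ^ k)) * h₂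
    · have u : ¬ linkedUp (2 * k) true = true := by simp [linkedUp]
      rw [if_neg u]
      rcases Nat.eq_zero_or_pos k with rfl | hk
      · simp
      · obtain ⟨l, rfl⟩ : ∃ l, k = l + 1 := ⟨k - 1, by omega⟩
        have e3 : (2 * (l + 1) - 1) / 2 = l := by omega
        have e4 : (2 * (l + 1) - 1) % 2 = 1 := by omega
        rw [if_pos (by omega), if_neg (by rintro ⟨h | h, _⟩ <;> omega)]
        simp only [Pi.neg_apply, smallCoeff, e1, e2, e3, e4, if_true, one_ne_zero, if_false,
          pow_succ]
        field_simp
        linear_combination (-(A * g x * (-(g x / c ^ 2)) ^ l)) * h₁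
  · have e1 : (2 * k + 1) / 2 = k := by omega
    have e2 : (2 * k + 1) % 2 = 1 := by omega
    cases b
    · have e3 : (2 * k + 1 - 1) / 2 = k := by omega
      have e4 : (2 * k + 1 - 1) % 2 = 0 := by omega
      have u : ¬ linkedUp (2 * k + 1) false = true := by simp [linkedUp, e2]
      rw [if_neg u, if_pos (by omega), if_neg (by simp)]
      simp only [Pi.neg_apply, smallCoeff, e1, e2, e3, e4, if_true, one_ne_zero, if_false,
        Bool.false_eq_true]
      field_simp
      linear_combination (A * g x * (-(g x / c ^ 2)) ^ k) * h₁
    · have u : linkedUp (2 * k + 1) true = true := by simp [linkedUp, e2]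
      rw [if_pos u]
      by_cases v : 2 * k + 1 + 1 < 2 * L + 2
      · have e3 : (2 * k + 1 + 1) / 2 = k + 1 := by omega
        have e4 : (2 * k + 1 + 1) % 2 = 0 := by omega
        rw [if_pos v, if_neg (by rintro ⟨h | h, _⟩ <;> omega)]
        simp only [Pi.neg_apply, smallCoeff, e1, e2, e3, e4, if_true, one_ne_zero, if_false,
          pow_succ]
        field_simp
        linear_combination (A * g x * (-(g x / c ^ 2)) ^ k) * h₂
      · rw [if_neg v, if_pos ⟨Or.inr (by omega), rfl⟩]
        rfl

theorem norm_sq_largeCoeff_le (O : Oracle n a) {x₀ : Bits n} {c s : ℝ} (A : ℝ)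
    (hs : s * labelProb (oracleState O) x₀ = 1 - labelProb (oracleState O) x₀)
    (h0 : 0 ≤ c ^ 2 * s) (h1 : c ^ 2 * s < 1) :
    ‖siteVec K L (oracleState O) (largeCoeff x₀ A c s)‖ ^ 2 ≤ 2 * A ^ 2 / (1 - c ^ 2 * s) := by
  rw [norm_sq_siteVec, show 2 * L + 2 = 2 * (L + 1) by ring, sum_range_two_mul]
  have hx : ∀ j, ∑ x, (largeCoeff x₀ A c s j x true ^ 2 * labelProb (oracleState O) x +
      largeCoeff x₀ A c s j x false ^ 2 * (1 - labelProb (oracleState O) x)) =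
      largeCoeff x₀ A c s j x₀ true ^ 2 * labelProb (oracleState O) x₀ +
      largeCoeff x₀ A c s j x₀ false ^ 2 * (1 - labelProb (oracleState O) x₀) := by
    intro j
    refine Finset.sum_eq_single x₀ (fun x _ hx => ?_) (by simp)
    simp [largeCoeff, hx]
  simp only [hx]
  generalize labelProb (oracleState O) x₀ = Y at *
  have hk : ∀ k, (largeCoeff x₀ A c s (2 * k) x₀ true ^ 2 * Y +
      largeCoeff x₀ A c s (2 * k) x₀ false ^ 2 * (1 - Y) +
      (largeCoeff x₀ A c s (2 * k + 1) x₀ true ^ 2 * Y +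
      largeCoeff x₀ A c s (2 * k + 1) x₀ false ^ 2 * (1 - Y))) ≤
      2 * A ^ 2 * ((c ^ 2 * s) ^ k) ^ 2 := by
    intro k
    have e1 : (2 * k + 1) / 2 = k := by omega
    have e2 : (2 * k + 1) % 2 = 1 := by omega
    have e3 : (2 * k) / 2 = k := by omega
    have e4 : (2 * k) % 2 = 0 := by omega
    have e5 : ((-(c ^ 2 * s)) ^ k) ^ 2 = ((c ^ 2 * s) ^ k) ^ 2 := by
      rw [← pow_mul, ← pow_mul, mul_comm k 2, pow_mul, pow_mul, neg_sq]
    simp only [largeCoeff, e1, e2, e3, e4, if_true, one_ne_zero, if_false, Bool.false_eq_true,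
      mul_pow _ _ 2]
    rw [e5]
    -- The pair of sites has weight `1 + c² s ≤ 2`, up to the geometric factor.
    have e6 : s ^ 2 * Y + (1 - Y) = s := by linear_combination (s - 1) * hs
    have e7 : A ^ 2 * ((c ^ 2 * s) ^ k) ^ 2 * (1 + c ^ 2 * s) ≤
        A ^ 2 * ((c ^ 2 * s) ^ k) ^ 2 * 2 := by
      gcongr
      linarith
    refine le_trans (le_of_eq ?_) (e7.trans (le_of_eq (by ring)))
    linear_combination (A ^ 2 * ((c ^ 2 * s) ^ k) ^ 2 * c ^ 2) * e6
  refine (Finset.sum_le_sum fun k _ => hk k).trans ?_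
  rw [← Finset.mul_sum]
  refine (mul_le_mul_of_nonneg_left (geom_sum_sq_le h0 h1 _) (by positivity)).trans
    (le_of_eq (by ring))

/-- For one label, a pair of sites has weight `g (1 + g / c²) ≤ 2 g` times a geometric factor. Only
squares of coefficients enter, so the statement allows changes of sign, as at the entry. -/
theorem norm_sq_smallCoeff_le (O : Oracle n a) {c : ℝ} (hc : c ≠ 0) {A : ℝ} {g : Bits n → ℝ}
    (hg : ∀ x, g x * (1 - labelProb (oracleState O) x) = labelProb (oracleState O) x)
    (h0 : ∀ x, 0 ≤ g x) (h1 : ∀ x, g x / c ^ 2 < 1) (d : ℕ → Bits n → Bool → ℝ)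
    (hd : ∀ j x b, d j x b ^ 2 = smallCoeff A c g j x b ^ 2) :
    ‖siteVec K L (oracleState O) d‖ ^ 2 ≤ ∑ x, 2 * A ^ 2 * (g x / (1 - g x / c ^ 2)) := by
  rw [norm_sq_siteVec, Finset.sum_comm]
  refine Finset.sum_le_sum fun x _ => ?_
  rw [show 2 * L + 2 = 2 * (L + 1) by ring, sum_range_two_mul]
  simp only [hd]
  have hgx := hg x
  have h0x := h0 x
  have h1x := h1 x
  have hp : 0 ≤ g x / c ^ 2 := by positivity
  generalize labelProb (oracleState O) x = Y at *
  have hk : ∀ k, (smallCoeff A c g (2 * k) x true ^ 2 * Y +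
      smallCoeff A c g (2 * k) x false ^ 2 * (1 - Y) +
      (smallCoeff A c g (2 * k + 1) x true ^ 2 * Y +
      smallCoeff A c g (2 * k + 1) x false ^ 2 * (1 - Y))) ≤
      2 * A ^ 2 * g x * ((g x / c ^ 2) ^ k) ^ 2 := by
    intro k
    have e1 : (2 * k + 1) / 2 = k := by omega
    have e2 : (2 * k + 1) % 2 = 1 := by omega
    have e3 : (2 * k) / 2 = k := by omega
    have e4 : (2 * k) % 2 = 0 := by omega
    have e5 : ((-(g x / c ^ 2)) ^ k) ^ 2 = ((g x / c ^ 2) ^ k) ^ 2 := by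
      rw [← pow_mul, ← pow_mul, mul_comm k 2, pow_mul, pow_mul, neg_sq]
    simp only [smallCoeff, e1, e2, e3, e4, if_true, one_ne_zero, if_false, Bool.false_eq_true,
      mul_pow _ _ 2]
    rw [e5]
    have e7 : A ^ 2 * ((g x / c ^ 2) ^ k) ^ 2 * (g x * (1 + g x / c ^ 2)) ≤
        A ^ 2 * ((g x / c ^ 2) ^ k) ^ 2 * (g x * 2) := by
      gcongr
      linarith
    refine le_trans (le_of_eq ?_) (e7.trans (le_of_eq (by ring)))
    have e8 : (g x / c) ^ 2 = g x * (g x / c ^ 2) := by field_simp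
    rw [e8]
    linear_combination (A ^ 2 * ((g x / c ^ 2) ^ k) ^ 2 * (g x - 1)) * hgx
  refine (Finset.sum_le_sum fun k _ => hk k).trans ?_
  rw [← Finset.mul_sum]
  refine (mul_le_mul_of_nonneg_left (geom_sum_sq_le hp h1x _) (by positivity)).trans
    (le_of_eq (by ring))

/-- The truncation error decays like `p ^ L` uniformly in the labels, since the weights `Y x` sum to
`1`. -/
theorem norm_sq_boundary_le (O : Oracle n a) {c : ℝ} (hc : c ≠ 0) {A p : ℝ} {g : Bits n → ℝ}
    (h0 : ∀ x, 0 ≤ g x) (h1 : ∀ x, g x / c ^ 2 ≤ p) (hp : p ≤ 1) (d : ℕ → Bits n → Bool → ℝ)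
    (hd : ∀ j < 2 * L + 2, ∀ x b, d j x b =
      if j = 2 * L + 1 ∧ b = true then -2 * smallCoeff A c g j x b else 0) :
    ‖siteVec K L (oracleState O) d‖ ^ 2 ≤ (2 * A * c * p ^ L) ^ 2 := by
  rw [norm_sq_siteVec, Finset.sum_eq_single (2 * L + 1)]
  · have hx : ∀ x, d (2 * L + 1) x true ^ 2 * labelProb (oracleState O) x +
        d (2 * L + 1) x false ^ 2 * (1 - labelProb (oracleState O) x) ≤
        (2 * A * c * p ^ L) ^ 2 * labelProb (oracleState O) x := by
      intro x
      have e1 : (2 * L + 1) / 2 = L := by omega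
      have e2 : (2 * L + 1) % 2 = 1 := by omega
      have hpx : 0 ≤ g x / c ^ 2 := div_nonneg (h0 x) (by positivity)
      rw [hd _ (by omega), hd _ (by omega)]
      simp only [smallCoeff, e1, e2, if_true, one_ne_zero, if_false, Bool.false_eq_true, and_self,
        and_false]
      rw [zero_pow two_ne_zero, zero_mul, add_zero]
      refine mul_le_mul_of_nonneg_right ?_ (labelProb_nonneg _ _)
      have e3 : (-2 * (A * (-(g x / c ^ 2)) ^ L * (g x / c))) ^ 2 =
          (2 * A * c) ^ 2 * (((g x / c ^ 2) ^ L) ^ 2 * (g x / c ^ 2) ^ 2) := by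
        have e5 : ((-(g x / c ^ 2)) ^ L) ^ 2 = ((g x / c ^ 2) ^ L) ^ 2 := by
          rw [← pow_mul, ← pow_mul, mul_comm L 2, pow_mul, pow_mul, neg_sq]
        have e6 : g x / c = c * (g x / c ^ 2) := by field_simp
        rw [e6, mul_pow, mul_pow, mul_pow A, e5]
        ring
      rw [e3, mul_pow (2 * A * c)]
      refine mul_le_mul_of_nonneg_left ?_ (by positivity)
      have e7 : (g x / c ^ 2) ^ 2 ≤ 1 := pow_le_one₀ hpx ((h1 x).trans hp)
      have e8 : (g x / c ^ 2) ^ L ≤ p ^ L := pow_le_pow_left₀ hpx (h1 x) L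
      have e9 : ((g x / c ^ 2) ^ L) ^ 2 ≤ (p ^ L) ^ 2 :=
        pow_le_pow_left₀ (pow_nonneg hpx _) e8 2
      calc _ ≤ ((g x / c ^ 2) ^ L) ^ 2 * 1 := by gcongr
        _ ≤ _ := by linarith
    refine (Finset.sum_le_sum fun x _ => hx x).trans ?_
    rw [← Finset.mul_sum, sum_labelProb, mul_one]
  · intro j hj hj'
    refine Finset.sum_eq_zero fun x _ => ?_
    rw [hd j (Finset.mem_range.mp hj), hd j (Finset.mem_range.mp hj)]
    simp [hj']
  · simp

end

/-! ### Estimates of the decay rates -/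

theorem large_rate_le {t τ Y : ℝ} (ht0 : 0 < t) (htτ : t < τ) (ht1 : t ^ 2 < 1)
    (hY : τ ^ 2 ≤ Y) : t ^ 2 / (1 - t ^ 2) * ((1 - Y) / Y) ≤ t / τ := by
  have hτ0 : 0 < τ := ht0.trans htτ
  have hY0 : 0 < Y := lt_of_lt_of_le (by positivity) hY
  have h1 : 0 < 1 - t ^ 2 := by linarith
  rw [div_mul_div_comm, div_le_div_iff₀ (by positivity) hτ0]
  have h2 : t * τ ≤ τ * τ := mul_le_mul_of_nonneg_right htτ.le hτ0.le
  have h3 : t * t ≤ t * τ := mul_le_mul_of_nonneg_left htτ.le ht0.le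
  have h4 : t * t * Y ≤ t * τ * Y := mul_le_mul_of_nonneg_right h3 hY0.le
  have h5 : t * τ * (1 - Y) ≤ (1 - t ^ 2) * Y := by linarith
  have h6 := mul_le_mul_of_nonneg_left h5 ht0.le
  linarith

theorem small_rate_eq {t Y : ℝ} (ht0 : 0 < t) (hYt : Y < t ^ 2) (ht1 : t ^ 2 < 1) :
    Y / (1 - Y) / (1 - Y / (1 - Y) / (t ^ 2 / (1 - t ^ 2))) = Y * (t ^ 2 / (t ^ 2 - Y)) := by
  have h1 : 1 - Y ≠ 0 := by linarith
  have h2 : t ^ 2 - Y ≠ 0 := by linarith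
  have h3 : 1 - t ^ 2 ≠ 0 := by linarith
  have h4 : 1 - Y / (1 - Y) / (t ^ 2 / (1 - t ^ 2)) = (t ^ 2 - Y) / ((1 - Y) * t ^ 2) := by
    field_simp
    ring
  rw [h4]
  field_simp

/-- The gap is `t² - Y ≥ t² - (τ - ε)² ≥ ε t / 2`, so the quotient is at most `2 t / ε`. -/
theorem small_rate_le {τ ε t Y : ℝ} (hε0 : 0 < ε) (hε1 : ε < τ) (ht : t = τ - ε / 2)
    (hY : Y ≤ (τ - ε) ^ 2) : t ^ 2 / (t ^ 2 - Y) ≤ 2 * τ / ε := by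
  have ht0 : 0 < t := by linarith
  have h1 : t ^ 2 - (τ - ε) ^ 2 = ε / 2 * (t + (τ - ε)) := by rw [ht]; ring
  have h2 : 0 < ε / 2 * (τ - ε) := by
    have : 0 < τ - ε := by linarith
    positivity
  have h3 : 0 < ε / 2 * t := by positivity
  have h4 : ε / 2 * t ≤ t ^ 2 - Y := by linarith
  rw [div_le_div_iff₀ (by linarith) hε0]
  have h5 := mul_le_mul_of_nonneg_left h4 (show 0 ≤ 2 * τ by linarith)
  have h6 : t * (ε * t) ≤ τ * (ε * t) :=
    mul_le_mul_of_nonneg_right (by linarith) (by positivity)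
  linarith

/-! ### Existence of catalysts and the algorithm with constant error -/

section
set_option synthInstance.maxSize 1000
variable {n a : ℕ}

/-- For a large enough walk there are catalysts of squared norm at most `4 / (ε * τ)` with which a
step preserves the clock state if some label has a large amplitude, and negates it up to an error
`η` if all labels have small amplitudes. -/
theorem exists_catalyst (n a : ℕ) {τ ε η : ℝ} (hτ0 : 0 < τ) (hτ1 : τ < 1) (hε0 : 0 < ε)
    (hε1 : ε < τ) (hη : 0 < η) :
    ∃ (L : ℕ) (κ t : ℝ) (ht : t ^ 2 ≤ 1), ∀ (K : ℕ) (O : Oracle n a) (α : Bits n → ℂ)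
      (ψ : Bits n → EuclideanSpace ℂ (Bits a)), Generates O α ψ →
      ((∃ x, τ ≤ ‖α x‖) → ∃ v : RegSpace n a (WalkWork n K L), ‖v‖ ^ 2 ≤ 4 / (ε * τ) ∧
        ∀ k : Fin K, walkStep L κ ht k O
            (EuclideanSpace.single (clockState n a L (some k)) 1 + v) =
          EuclideanSpace.single (clockState n a L (some k)) 1 + v) ∧
      ((∀ x, ‖α x‖ < τ - ε) → ∃ v : RegSpace n a (WalkWork n K L), ‖v‖ ^ 2 ≤ 4 / (ε * τ) ∧
        ∀ k : Fin K, ‖walkStep L κ ht k O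
            (EuclideanSpace.single (clockState n a L (some k)) 1 + v) -
          (-EuclideanSpace.single (clockState n a L (some k)) 1 + v)‖ ≤ η) := by
  obtain ⟨t, ht_def⟩ : ∃ t, t = τ - ε / 2 := ⟨_, rfl⟩
  obtain ⟨m, hm_def⟩ : ∃ m, m = τ - ε := ⟨_, rfl⟩
  have ht0 : 0 < t := by linarith
  have htτ : t < τ := by linarith
  have hm0 : 0 < m := by linarith
  have hmt : m < t := by linarith
  have ht2 : t ^ 2 < 1 := by nlinarith
  have hm2 : m ^ 2 < t ^ 2 := by nlinarith
  have hr : 0 < Real.sqrt (1 - t ^ 2) := Real.sqrt_pos.mpr (by linarith)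
  have hr2 : Real.sqrt (1 - t ^ 2) ^ 2 = 1 - t ^ 2 := Real.sq_sqrt (by linarith)
  obtain ⟨c, hc_def⟩ : ∃ c, c = t / Real.sqrt (1 - t ^ 2) := ⟨_, rfl⟩
  have hc0 : 0 < c := by rw [hc_def]; positivity
  have hc2 : c ^ 2 = t ^ 2 / (1 - t ^ 2) := by rw [hc_def, div_pow, hr2]
  have h₁ : (1 - 2 * t ^ 2) + 2 * t * Real.sqrt (1 - t ^ 2) * c = 1 := by
    rw [hc_def]
    field_simp
    ring
  have h₂ : 2 * t * Real.sqrt (1 - t ^ 2) - (1 - 2 * t ^ 2) * c = c := by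
    rw [hc_def]
    field_simp
    linear_combination 2 * hr2
  have ht2' : 0 < 1 - t ^ 2 := by linarith
  have hm2' : 0 < 1 - m ^ 2 := by linarith
  obtain ⟨p, hp_def⟩ : ∃ p, p = m ^ 2 / (1 - m ^ 2) / c ^ 2 := ⟨_, rfl⟩
  have hp1 : p < 1 := by
    rw [hp_def, hc2, div_lt_one (by positivity), div_lt_div_iff₀ hm2' ht2']
    nlinarith
  have hp0 : 0 ≤ p := by rw [hp_def]; positivity
  -- The length of the line only makes the truncation error small; it affects neither the query
  -- count nor the norm bounds.
  obtain ⟨L, hL⟩ := exists_pow_lt_of_lt_one (show 0 < η / (2 * (1 / τ) * c) by positivity) hp1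
  refine ⟨L, 1 / τ, t, ht2.le, fun K O α ψ hgen => ⟨?_, ?_⟩⟩
  · rintro ⟨x₀, hx₀⟩
    have hY := hgen.labelProb_eq x₀
    have hYτ : τ ^ 2 ≤ labelProb (oracleState O) x₀ := by
      rw [hY]
      exact pow_le_pow_left₀ hτ0.le hx₀ 2
    have hY1 : labelProb (oracleState O) x₀ ≤ 1 := by
      rw [← sum_labelProb O]
      exact Finset.single_le_sum (fun x _ => labelProb_nonneg _ x) (Finset.mem_univ x₀)
    obtain ⟨Y, hY_def⟩ : ∃ Y, Y = labelProb (oracleState O) x₀ := ⟨_, rfl⟩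
    rw [← hY_def] at hYτ hY1
    have hY0 : 0 < Y := lt_of_lt_of_le (by positivity) hYτ
    have hs : (1 - Y) / Y * labelProb (oracleState O) x₀ =
        1 - labelProb (oracleState O) x₀ := by
      rw [← hY_def]
      field_simp
    have hs0 : 0 ≤ (1 - Y) / Y := div_nonneg (by linarith) hY0.le
    have hq : c ^ 2 * ((1 - Y) / Y) ≤ t / τ := by
      rw [hc2]
      exact large_rate_le ht0 htτ ht2 hYτ
    have hqτ : 1 - t / τ = ε / (2 * τ) := by
      rw [ht_def]
      field_simp
      ring
    have hε' : 0 < ε / (2 * τ) := by positivity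
    -- With `κ = 1 / τ`, the amplitude `-(τ / Y)` gives overlap `κ * A * Y = -1` with the entry,
    -- cancelling the overlap `1` of the clock state. It is at most `1 / τ` in absolute value.
    refine ⟨siteVec K L (oracleState O) (largeCoeff x₀ (-(τ / Y)) c ((1 - Y) / Y)), ?_, ?_⟩
    · refine (norm_sq_largeCoeff_le O _ hs (by positivity) (by linarith)).trans ?_
      have hA : (-(τ / Y)) ^ 2 ≤ 1 / τ ^ 2 := by
        rw [neg_sq, div_pow, div_le_div_iff₀ (by positivity) (by positivity)]
        have := pow_le_pow_left₀ (sq_nonneg τ) hYτ 2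
        linarith
      calc 2 * (-(τ / Y)) ^ 2 / (1 - c ^ 2 * ((1 - Y) / Y))
          ≤ 2 * (1 / τ ^ 2) / (ε / (2 * τ)) := by
            gcongr
            linarith
        _ = 4 / (ε * τ) := by
            field_simp
            norm_num
    · intro k
      refine walkStep_invariant _ _ _ ?_ (fun j _ => ?_) (fun j _ => ?_)
      · rw [Finset.sum_eq_single x₀ (fun x _ hx => by simp [largeCoeff, hx]) (by simp), ← hY_def]
        simp only [largeCoeff, if_true]
        field_simp
        simp
      · rw [reflCoeff_largeCoeff hs]
      · rw [linkCoeff_largeCoeff h₁ h₂]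
  · intro hx
    have hYm : ∀ x, labelProb (oracleState O) x ≤ m ^ 2 := fun x => by
      rw [hgen.labelProb_eq x, hm_def]
      exact pow_le_pow_left₀ (norm_nonneg _) (hx x).le 2
    obtain ⟨g, hg_def⟩ : ∃ g : Bits n → ℝ, ∀ x, g x =
      labelProb (oracleState O) x / (1 - labelProb (oracleState O) x) := ⟨_, fun _ => rfl⟩
    have hY1 : ∀ x, 0 < 1 - labelProb (oracleState O) x := fun x => by linarith [hYm x]
    have hg : ∀ x, g x * (1 - labelProb (oracleState O) x) = labelProb (oracleState O) x :=
      fun x => by rw [hg_def, div_mul_cancel₀ _ (hY1 x).ne']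
    have hg0 : ∀ x, 0 ≤ g x := fun x => by
      rw [hg_def]
      exact div_nonneg (labelProb_nonneg _ _) (hY1 x).le
    have hgp : ∀ x, g x / c ^ 2 ≤ p := fun x => by
      rw [hp_def, hg_def]
      have h3 : labelProb (oracleState O) x / (1 - labelProb (oracleState O) x) ≤
          m ^ 2 / (1 - m ^ 2) := by
        rw [div_le_div_iff₀ (hY1 x) hm2']
        nlinarith [hYm x]
      gcongr
    have hentry : ∀ x, smallCoeff (-(1 / τ)) c g 0 x true = -(1 / τ) := fun x => by
      simp [smallCoeff]
    refine ⟨siteVec K L (oracleState O)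
      (smallCoeff (-(1 / τ)) c g + (2 * (1 / τ)) • entryCoeff n), ?_, fun k => ?_⟩
    · refine (norm_sq_smallCoeff_le O hc0.ne' (A := -(1 / τ)) hg hg0
        (fun x => (hgp x).trans_lt hp1) _ ?_).trans ?_
      · intro j x b
        by_cases hj : j = 0 ∧ b = true
        · obtain ⟨rfl, rfl⟩ := hj
          simp only [Pi.add_apply, Pi.smul_apply, hentry, entryCoeff]
          simp
          ring
        · simp [entryCoeff, hj]
      · have h3 : ∀ x, 2 * (-(1 / τ)) ^ 2 * (g x / (1 - g x / c ^ 2)) ≤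
            4 / (ε * τ) * labelProb (oracleState O) x := by
          intro x
          have hYx := hYm x
          have hY0 := labelProb_nonneg (oracleState O) x
          have hY1x := hY1 x
          have e1 : g x / (1 - g x / c ^ 2) = labelProb (oracleState O) x *
              (t ^ 2 / (t ^ 2 - labelProb (oracleState O) x)) := by
            rw [hg_def, hc2]
            exact small_rate_eq ht0 (by linarith) ht2
          have e2 : t ^ 2 / (t ^ 2 - labelProb (oracleState O) x) ≤ 2 * τ / ε :=
            small_rate_le hε0 hε1 ht_def (hm_def ▸ hYx)
          rw [e1]
          calc _ ≤ 2 * (-(1 / τ)) ^ 2 * (labelProb (oracleState O) x * (2 * τ / ε)) := by gcongr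
            _ = _ := by
              field_simp
              ring
        refine (Finset.sum_le_sum fun x _ => h3 x).trans ?_
        rw [← Finset.mul_sum, sum_labelProb, mul_one]
    · rw [walkStep_negate _ _ _ hentry (fun j _ => by rw [reflCoeff_smallCoeff hg]; rfl),
        add_sub_add_left_eq_sub]
      have h3 : ∀ d d' : ℕ → Bits n → Bool → ℝ, siteVec K L (oracleState O) d -
          siteVec K L (oracleState O) d' = siteVec K L (oracleState O) (d + (-1 : ℝ) • d') := by
        intro d d'
        rw [siteVec_add, siteVec_smul]
        push_cast
        module
      rw [h3]
      refine (sq_le_sq₀ (norm_nonneg _) hη.le).mp ((norm_sq_boundary_le O hc0.ne' (A := -(1 / τ))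
        hg0 hgp hp1.le _ ?_).trans ?_)
      · intro j hj x b
        simp only [Pi.add_apply, Pi.smul_apply, smul_eq_mul]
        rw [linkCoeff_neg_smallCoeff hc0.ne' h₁ h₂ _ _ j hj]
        -- At the entry the fixed value `-z = κ` equals `z + 2 κ`, so no error remains there.
        rcases Nat.eq_zero_or_pos j with rfl | hj0
        · cases b
          · simp [entryCoeff]
          · rw [hentry]
            simp [entryCoeff]
            ring
        · by_cases hjb : j = 2 * L + 1 ∧ b = true
          · rw [if_pos ⟨Or.inr hjb.1, hjb.2⟩, if_pos hjb]
            simp [entryCoeff, hj0.ne']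
            ring
          · rw [if_neg hjb, if_neg (by rintro ⟨h | h, hb⟩; exacts [hj0.ne' h, hjb ⟨h, hb⟩])]
            simp [entryCoeff, hj0.ne']
      · have h4 : 2 * (1 / τ) * c * p ^ L ≤ η := by
          rw [lt_div_iff₀ (by positivity)] at hL
          linarith
        have h5 : 0 ≤ 2 * (1 / τ) * c * p ^ L := by positivity
        have h6 : (2 * -(1 / τ) * c * p ^ L) ^ 2 = (2 * (1 / τ) * c * p ^ L) ^ 2 := by ring
        rw [h6]
        exact pow_le_pow_left₀ h5 h4 2

/-- HighAmp is decided with `O(1 / (ε * τ))` queries and a constant error. -/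
theorem exists_impl_highAmp (n a : ℕ) {τ ε : ℝ} (hτ0 : 0 < τ) (hτ1 : τ < 1) (hε0 : 0 < ε)
    (hε1 : ε < τ) :
    ∃ (W : Type) (_ : Fintype W) (_ : DecidableEq W)
      (T : Oracle n a → RegSpace n a W ≃ₗᵢ[ℂ] RegSpace n a W) (i₀ i₁ : Reg n a W),
      Impl W (⌈512 / (ε * τ)⌉₊ * 4) T ∧
      ∀ (O : Oracle n a) (α : Bits n → ℂ) (ψ : Bits n → EuclideanSpace ℂ (Bits a)),
        Generates O α ψ →
        ((∃ x, τ ≤ ‖α x‖) →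
          ‖T O (EuclideanSpace.single i₀ 1) - EuclideanSpace.single i₀ 1‖ ≤ 1 / 4) ∧
        ((∀ x, ‖α x‖ < τ - ε) →
          ‖T O (EuclideanSpace.single i₀ 1) - EuclideanSpace.single i₁ 1‖ ≤ 1 / 4) ∧ i₁ ≠ i₀ := by
  -- This makes `K ≥ 128 * ‖v‖ ^ 2`, so `2 * ‖v‖` is at most an eighth of `√(2 K)`; the choice `η =
  -- 1 / (8 K)` contributes at most another eighth.
  set K := ⌈512 / (ε * τ)⌉₊ with hK
  have hK0 : 0 < K := Nat.ceil_pos.mpr (by positivity)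
  have hKR : (1 : ℝ) ≤ K := by exact_mod_cast hK0
  have hKV : 512 / (ε * τ) ≤ K := Nat.le_ceil _
  obtain ⟨L, κ, t, ht, hcat⟩ := exists_catalyst n a (η := 1 / (8 * K)) hτ0 hτ1 hε0 hε1
    (by positivity)
  have hinj : ∀ s s' : Option (Fin K), clockState n a L s = clockState n a L s' → s = s' := by
    intro s s' h
    simpa [clockState] using h
  obtain ⟨Φ, hΦ, h⟩ := exists_impl_sign hK0
    (fun k => impl_walkStep (n := n) (a := a) (L := L) κ ht k)
    (fun k => clockState n a L (some k)) (fun k k' hk => by simpa using hinj _ _ hk)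
    (fun O k k' hk => walkStep_clockState ht k O _ (by simpa using hk))
    (clockState n a L none) (fun k hk => by simpa using hinj _ _ hk)
    (fun O k => walkStep_clockState ht k O _ (by simp))
  have bound : ∀ v : RegSpace n a (WalkWork n K L), ‖v‖ ^ 2 ≤ 4 / (ε * τ) →
      (2 * ‖v‖ + K * (1 / (8 * K))) / Real.sqrt (2 * K) ≤ 1 / 4 := by
    intro v hv
    have hs : 1 ≤ Real.sqrt (2 * K) := Real.one_le_sqrt.mpr (by linarith)
    have hv2 : 16 * ‖v‖ ≤ Real.sqrt (2 * K) := by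
      refine Real.le_sqrt_of_sq_le ?_
      have : 512 / (ε * τ) = 128 * (4 / (ε * τ)) := by ring
      nlinarith
    have hK8 : (K : ℝ) * (1 / (8 * K)) = 1 / 8 := by field_simp
    rw [div_le_iff₀ (by linarith), hK8]
    linarith
  refine ⟨_, inferInstance, inferInstance, Φ, clockState n a L none,
    clockState n a L (some ⟨0, hK0⟩), hΦ, fun O α ψ hgen => ⟨fun hx => ?_, fun hx => ?_, ?_⟩⟩
  · obtain ⟨v, hv, hv'⟩ := (hcat K O α ψ hgen).1 hx
    refine (h O v true (1 / (8 * K)) fun k => ?_).trans (bound v hv)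
    rw [if_pos rfl, one_smul, hv' k, sub_self, norm_zero]
    positivity
  · obtain ⟨v, hv, hv'⟩ := (hcat K O α ψ hgen).2 hx
    refine (h O v false (1 / (8 * K)) fun k => ?_).trans (bound v hv)
    rw [if_neg (by simp), neg_one_smul]
    exact hv' k
  · intro hc
    simpa using hinj _ _ hc

end

/-! ### Error reduction and the query bound -/

section
variable {n a : ℕ}

/-- Needed for `δ ≥ 1 / 2`: when `δ` and `τ` are close to `1` the bound on the number of queries may
be below `1`, so no call can be afforded. -/
theorem exists_coin (n a : ℕ) : ∃ A : QueryAlgorithm n a, A.queries = 0 ∧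
    ∀ O b, 1 / 2 ≤ A.outputProb O b := by
  classical
  let i : Bool → Reg n a Unit := fun b => (b, (zeroBits n, zeroBits a), ())
  have hi : Function.Injective i := fun b b' h => congrArg Prod.fst h
  have hne : i true ≠ i false := fun h => by simpa using hi h
  have hon := (EuclideanSpace.orthonormal_single (𝕜 := ℂ) (ι := Reg n a Unit)).comp i hi
  obtain ⟨g, hg⟩ := exists_isometry_of_orthonormal hon
    (orthonormal_sum_diff (hon.1 true) (hon.1 false) (hon.2 (by simp)))
  obtain ⟨A, hA, hout⟩ := (Impl.gate (n := n) (a := a) g).exists_queryAlgorithm (i true) Prod.fst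
  refine ⟨A, hA, fun O b => ?_⟩
  rw [hout]
  have hterm : ‖g (EuclideanSpace.single (i true) 1) (i b)‖ ^ 2 = 1 / 2 := by
    have h := hg true
    simp only [Function.comp_apply] at h
    have hs : ‖((Real.sqrt 2)⁻¹ : ℂ)‖ ^ 2 = 1 / 2 := by
      rw [norm_inv, Complex.norm_real, Real.norm_of_nonneg (Real.sqrt_nonneg _), inv_pow,
        Real.sq_sqrt (by norm_num), one_div]
    rw [h, ← hs]
    cases b <;> simp [hne, hne.symm]
  rw [← hterm]
  refine le_trans (le_of_eq ?_) (Finset.single_le_sum (fun j _ => ?_) (Finset.mem_univ (i b)))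
  · rw [if_pos (show (i b).1 = b from rfl)]
  · split_ifs
    · positivity
    · exact le_rfl

/-- The weight of a set of basis states that does not contain `i` is small in a state that is close
to the basis state `i`. -/
theorem sum_ite_le_of_near {I : Type*} [Fintype I] [DecidableEq I] (v : EuclideanSpace ℂ I) (i : I)
    {r : ℝ} (h : ‖v - EuclideanSpace.single i 1‖ ≤ r) (P : I → Prop) [DecidablePred P]
    (hi : ¬ P i) : ∑ j, (if P j then ‖v j‖ ^ 2 else 0) ≤ r ^ 2 := by
  refine le_trans ?_ (pow_le_pow_left₀ (norm_nonneg _) h 2)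
  rw [EuclideanSpace.norm_sq_eq]
  refine Finset.sum_le_sum fun j _ => ?_
  split_ifs with hj
  · have : j ≠ i := fun h => hi (h ▸ hj)
    simp [this]
  · positivity

/-- Amplification of the success probability by a majority vote. -/
theorem Impl.exists_majority {W : Type} [Fintype W] [DecidableEq W] {k : ℕ}
    {T : Oracle n a → RegSpace n a W ≃ₗᵢ[ℂ] RegSpace n a W} (hT : Impl W k T) (i₀ : Reg n a W)
    (flag : Reg n a W → Prop) [DecidablePred flag] (m : ℕ) :
    ∃ A : QueryAlgorithm n a, A.queries = m * k ∧ ∀ O,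
      (∑ i, (if ¬ flag i then ‖T O (EuclideanSpace.single i₀ 1) i‖ ^ 2 else 0) ≤ 1 / 16 →
        1 - (19 / 32) ^ m ≤ A.outputProb O true) ∧
      (∑ i, (if flag i then ‖T O (EuclideanSpace.single i₀ 1) i‖ ^ 2 else 0) ≤ 1 / 16 →
        1 - (19 / 32) ^ m ≤ A.outputProb O false) := by
  obtain ⟨V, _, _, S, j₀, count, hS, hgen⟩ :=
    hT.exists_repetition i₀ (fun i => if flag i then 1 else 0) m
  obtain ⟨A, hA, hout⟩ := hS.exists_queryAlgorithm j₀ (fun j => decide (m ≤ 2 * count j))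
  refine ⟨A, hA, fun O => ?_⟩
  have hgenO := hgen O
  have houtO := hout O
  have hS1 : ∑ j, ‖S O (EuclideanSpace.single j₀ 1) j‖ ^ 2 = 1 := by
    rw [← EuclideanSpace.norm_sq_eq]
    simp
  have hT1 : ∑ i, ‖T O (EuclideanSpace.single i₀ 1) i‖ ^ 2 = 1 := by
    rw [← EuclideanSpace.norm_sq_eq]
    simp
  generalize hξ : T O (EuclideanSpace.single i₀ 1) = ξ at *
  generalize hΨ : S O (EuclideanSpace.single j₀ 1) = Ψ at *
  have hsplit : ∑ i, (if flag i then ‖ξ i‖ ^ 2 else 0) +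
      ∑ i, (if ¬ flag i then ‖ξ i‖ ^ 2 else 0) = 1 := by
    rw [← Finset.sum_add_distrib, ← hT1]
    refine Finset.sum_congr rfl fun i _ => ?_
    by_cases hi : flag i <;> simp [hi]
  have hgen' : ∀ θ : ℝ, ∑ i, ‖ξ i‖ ^ 2 * θ ^ (if flag i then 1 else 0) =
      θ * ∑ i, (if flag i then ‖ξ i‖ ^ 2 else 0) +
        ∑ i, (if ¬ flag i then ‖ξ i‖ ^ 2 else 0) := by
    intro θ
    rw [Finset.mul_sum, ← Finset.sum_add_distrib]
    refine Finset.sum_congr rfl fun i _ => ?_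
    by_cases hi : flag i <;> simp [hi, mul_comm]
  have hcompl : A.outputProb O true + A.outputProb O false = 1 := by
    rw [houtO, houtO, ← Finset.sum_add_distrib, ← hS1]
    refine Finset.sum_congr rfl fun j _ => ?_
    by_cases h : m ≤ 2 * count j <;> simp [h]
  constructor
  · intro h
    have hwrong : A.outputProb O false ≤ (19 / 32) ^ m := by
      rw [houtO]
      -- Chernoff bound: on a wrong majority `2 ^ m / 4 ^ count` is at least `1`, and its mean is a
      -- power of the mean of one run, at most `2 (1 / 4 * 15 / 16 + 1 / 16) = 19 / 32`.
      calc _ ≤ ∑ j, ‖Ψ j‖ ^ 2 * (1 / 4) ^ count j * 2 ^ m := by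
            refine Finset.sum_le_sum fun j _ => ?_
            split_ifs with hj
            · have hlt : 2 * count j ≤ m := by
                have := of_decide_eq_false hj
                omega
              have : (1 : ℝ) ≤ (1 / 4) ^ count j * 2 ^ m := by
                rw [one_div, inv_pow, inv_mul_eq_div, one_le_div (by positivity),
                  show (4 : ℝ) = 2 ^ 2 by norm_num, ← pow_mul]
                exact pow_le_pow_right₀ (by norm_num) hlt
              rw [mul_assoc]
              exact le_mul_of_one_le_right (by positivity) this
            · positivity
        _ = (2 * (1 / 4 * ∑ i, (if flag i then ‖ξ i‖ ^ 2 else 0) +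
              ∑ i, (if ¬ flag i then ‖ξ i‖ ^ 2 else 0))) ^ m := by
            rw [← Finset.sum_mul, hgenO, hgen', mul_pow, mul_comm]
        _ ≤ _ := by
            have h0 : 0 ≤ ∑ i, (if flag i then ‖ξ i‖ ^ 2 else 0) :=
              Finset.sum_nonneg fun i _ => by split_ifs <;> positivity
            have h1 : 0 ≤ ∑ i, (if ¬ flag i then ‖ξ i‖ ^ 2 else 0) :=
              Finset.sum_nonneg fun i _ => by split_ifs <;> positivity
            exact pow_le_pow_left₀ (by positivity) (by linarith) m
    linarith
  · intro h
    have hwrong : A.outputProb O true ≤ (19 / 32) ^ m := by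
      rw [houtO]
      -- The same with the weight `4 ^ count / 2 ^ m`; one run gives at most `(4 / 16 + 15 / 16) / 2
      -- = 19 / 32`.
      calc _ ≤ ∑ j, ‖Ψ j‖ ^ 2 * 4 ^ count j * (1 / 2) ^ m := by
            refine Finset.sum_le_sum fun j _ => ?_
            split_ifs with hj
            · have hle : m ≤ 2 * count j := of_decide_eq_true hj
              have : (1 : ℝ) ≤ 4 ^ count j * (1 / 2) ^ m := by
                rw [one_div, inv_pow, ← div_eq_mul_inv, one_le_div (by positivity),
                  show (4 : ℝ) = 2 ^ 2 by norm_num, ← pow_mul]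
                exact pow_le_pow_right₀ (by norm_num) hle
              rw [mul_assoc]
              exact le_mul_of_one_le_right (by positivity) this
            · positivity
        _ = (1 / 2 * (4 * ∑ i, (if flag i then ‖ξ i‖ ^ 2 else 0) +
              ∑ i, (if ¬ flag i then ‖ξ i‖ ^ 2 else 0))) ^ m := by
            rw [← Finset.sum_mul, hgenO, hgen', mul_pow, mul_comm]
        _ ≤ _ := by
            have h0 : 0 ≤ ∑ i, (if flag i then ‖ξ i‖ ^ 2 else 0) :=
              Finset.sum_nonneg fun i _ => by split_ifs <;> positivity
            have h1 : 0 ≤ ∑ i, (if ¬ flag i then ‖ξ i‖ ^ 2 else 0) :=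
              Finset.sum_nonneg fun i _ => by split_ifs <;> positivity
            exact pow_le_pow_left₀ (by positivity) (by linarith) m
    linarith

theorem pow_ceil_log_le {δ : ℝ} (hδ : 0 < δ) : (19 / 32 : ℝ) ^ ⌈4 * Real.log (1 / δ)⌉₊ ≤ δ := by
  have h1 : (19 / 32 : ℝ) ≤ Real.exp (-(1 / 4)) := by
    have := Real.add_one_le_exp (-(1 / 4 : ℝ))
    linarith
  have h2 : 4 * Real.log (1 / δ) ≤ ⌈4 * Real.log (1 / δ)⌉₊ := Nat.le_ceil _
  calc (19 / 32 : ℝ) ^ ⌈4 * Real.log (1 / δ)⌉₊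
      ≤ Real.exp (-(1 / 4)) ^ ⌈4 * Real.log (1 / δ)⌉₊ := pow_le_pow_left₀ (by norm_num) h1 _
    _ = Real.exp (⌈4 * Real.log (1 / δ)⌉₊ * -(1 / 4)) := (Real.exp_nat_mul _ _).symm
    _ ≤ Real.exp (Real.log δ) := by
        rw [Real.exp_le_exp]
        rw [one_div, Real.log_inv] at *
        linarith
    _ = δ := Real.exp_log hδ

end

/-- There is an absolute constant `C` such that the promise version of HighAmp with threshold `τ`,
additive accuracy `ε` and error `δ` is solved with at most `C / (ε τ) * log (1 / (δ τ))` queries,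
whatever the numbers `n` and `a` of qubits are. -/
theorem mainTheorem9 :
    ∃ C : ℝ, 0 < C ∧
      ∀ (n a : ℕ) (τ ε δ : ℝ), 0 < τ → τ < 1 → 0 < ε → ε < τ → 0 < δ → δ < 1 →
        ∃ A : QueryAlgorithm n a,
          (A.queries : ℝ) ≤ C * (1 / (ε * τ) * Real.log (1 / (δ * τ))) ∧
          A.SolvesHighAmp τ ε δ := by
  -- `12312 = 6 * 513 * 4`: at most `6 log (1 / (δ τ))` repetitions, `513 / (ε τ)` walk steps, four
  -- queries per step.
  refine ⟨12312, by norm_num, fun n a τ ε δ hτ0 hτ1 hε0 hε1 hδ0 hδ1 => ?_⟩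
  have hετ : 0 < ε * τ := by positivity
  have hετ1 : 1 ≤ 1 / (ε * τ) := by
    rw [le_div_iff₀ hετ]
    nlinarith
  have hδτ : 1 / δ ≤ 1 / (δ * τ) := by
    apply one_div_le_one_div_of_le (by positivity)
    nlinarith
  have hlog : Real.log (1 / δ) ≤ Real.log (1 / (δ * τ)) :=
    Real.log_le_log (by positivity) hδτ
  have hlog0 : 0 ≤ Real.log (1 / δ) := Real.log_nonneg (by rw [le_div_iff₀ hδ0]; linarith)
  rcases le_or_gt (1 / 2) δ with hδ | hδ
  · obtain ⟨A, hA, hprob⟩ := exists_coin n a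
    refine ⟨A, ?_, fun O α ψ _ => ⟨fun _ => ?_, fun _ => ?_⟩⟩
    · rw [hA, Nat.cast_zero]
      have : 0 ≤ Real.log (1 / (δ * τ)) := hlog0.trans hlog
      positivity
    · linarith [hprob O true]
    · linarith [hprob O false]
  · obtain ⟨W, _, _, T, i₀, i₁, hT, hrun⟩ := exists_impl_highAmp n a hτ0 hτ1 hε0 hε1
    obtain ⟨A, hA, hmaj⟩ := hT.exists_majority i₀ (fun i => i = i₀) ⌈4 * Real.log (1 / δ)⌉₊
    have hpow := pow_ceil_log_le hδ0
    refine ⟨A, ?_, fun O α ψ hgen => ?_⟩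
    · rw [hA]
      push_cast
      -- Absorbs the rounding of the number of repetitions: `4 l + 1 ≤ 6 l` for `l ≥ 1 / 2`.
      have hl : 1 / 2 ≤ Real.log (1 / δ) := by
        have h1 : Real.log 2 ≤ Real.log (1 / δ) := by
          apply Real.log_le_log (by norm_num)
          rw [le_div_iff₀ hδ0]
          linarith
        linarith [Real.log_two_gt_d9]
      have h2 := (Nat.ceil_lt_add_one (show 0 ≤ 4 * Real.log (1 / δ) by positivity)).le
      have h3 := (Nat.ceil_lt_add_one (show 0 ≤ 512 / (ε * τ) by positivity)).le
      have h4 : (⌈4 * Real.log (1 / δ)⌉₊ : ℝ) ≤ 6 * Real.log (1 / (δ * τ)) := by linarith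
      have h5 : (⌈512 / (ε * τ)⌉₊ : ℝ) ≤ 513 * (1 / (ε * τ)) := by
        have : 512 / (ε * τ) = 512 * (1 / (ε * τ)) := by ring
        linarith
      have h6 : 0 ≤ 6 * Real.log (1 / (δ * τ)) := by linarith
      calc _ ≤ 6 * Real.log (1 / (δ * τ)) * (513 * (1 / (ε * τ)) * 4) := by gcongr
        _ = _ := by ring
    · obtain ⟨h1, h2, h3⟩ := hrun O α ψ hgen
      refine ⟨fun hx => ?_, fun hx => ?_⟩
      · have := (hmaj O).1 ((sum_ite_le_of_near _ _ (h1 hx) (fun i => ¬ i = i₀) (by simp)).trans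
          (by norm_num))
        linarith
      · have := (hmaj O).2 ((sum_ite_le_of_near _ _ (h2 hx) (fun i => i = i₀) h3).trans
          (by norm_num))
        linarith
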